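/- Fix $\alpha>0$. A random variable $Z\ge 0$ is $\alpha$-Fréchet with scale $\sigma\in[0,\infty]$ if $\mathbb P(Z\le x)=\exp\{-\sigma^\alpha x^{-\alpha}\}$ for all $x\in(0,\infty)$ (so $Z=0$ a.s. if $\sigma=0$, and $Z=\infty$ a.s. if $\sigma=\infty$). An $\alpha$-Fréchet process $X=\{X_t\}_{t\in T}$ is a real-valued max-stable process (for every $n\ge1$ the pointwise maximum of $n$ independent copies of $X$ has the law of $n^{1/\alpha}X$) with $\alpha$-Fréchet marginals of finite scale, scale $0$ being allowed. Let $(S,\mu)$ be a measure space, $L^\alpha_+(S,\mu)$ the set of measurable $f:S\to[0,\infty)$ with $\int f^\alpha d\mu<\infty$, with the metric $\int|f^\alpha-g^\alpha|\,d\mu$. An $\alpha$-Fréchet random sup-measure $M$ with control measure $\mu$ is a family of $[0,\infty]$-valued random variables $M(A)$, $A\subset S$ measurable, independent over disjoint sets, with $M(A)$ $\alpha$-Fréchet of scale $\mu(A)^{1/\alpha}$, and $M(\bigcup_iA_i)=\sup_iM(A_i)$ a.s. for every sequence of disjoint sets. The extremal integral of a simple function $\sum_i a_i1_{A_i}\in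 L^\alpha_+(S,\mu)$ ($A_i$ disjoint, $a_i\ge 0$) is $\max_i a_iM(A_i)$, and $\int^e_S f\,dM$ for $f\in L_+^\alpha(S,\mu)$ is the limit in probability of the extremal integrals of simple functions converging to $f$; write $\int^e_Bf\,dM=\int^e_Sf1_B\,dM$. A family $\{f_t\}_{t\in T}\subset L^\alpha_+(S,\mu)$ is a spectral representation of $X$ if $X$ equals in distribution $\{\int^e_S f_t\,dM\}_{t\in T}$ for a random sup-measure $M$ with control measure $\mu$. It is minimal if (a) its support is $S$ up to a $\mu$-null set, i.e. the closure in $L^\alpha_+(S,\mu)$ of the set of finite max-linear combinations $\max_j a_jf_{t_j}$, $a_j>0$, contains a function that is nonzero $\mu$-a.e.; and (b) for every measurable $B\subset S$ there is a set $A$ in the $\sigma$-field generated by the $[0,\infty]$-valued ratios $f_t/f_u$, $t,u\in T$ (with $0/0=0$), such that $\mu(A\Delta B)=0$. For $I\in\{0,1\}$ and $N\in\{0,1,2,\dots,\infty\}$ let $S_{I,N}$ be the union of $(0,1)$ (if $I=1$; $\emptyset$ if $I=0$) and $\{n\in\mathbb N: 1\le n\le N\}$, and let $\lambda_{I,N}$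 be Lebesgue measure on $(0,1)$ plus counting measure on the integers, restricted to $S_{I,N}$. A minimal representation over some $(S_{I,N},\lambda_{I,N})$ is said to have standardized support. A process has standardized support $S_{I,N}$ if it has a minimal representation over $(S_{I,N},\lambda_{I,N})$ and each of its minimal representations with standardized support is over this same space. **Theorem.** Let $X$ be an $\alpha$-Fréchet process with a minimal representation with standardized support $\{f_t\}_{t\in T}\subset L_+^\alpha(S_{I,N},\lambda_{I,N})$. Let $S_I=S_{I,N}\cap(0,1)=S_{I,0}$ and $S_N=S_{I,N}\cap\mathbb N=S_{0,N}$, with $\lambda_I=\lambda_{I,0}$ and $\lambda_N=\lambda_{0,N}$. Let $M$ be any $\alpha$-Fréchet random sup-measure with control measure $\lambda_{I,N}$, and put $$X^I_t=\int^e_{S_I}f_t\,dM,\qquad X^N_t=\int^e_{S_N}f_t\,dM,\qquad t\in T.$$ Then $X^I$ and $X^N$ are $\alpha$-Fréchet processes, $\{X_t\}_{t\in T}$ and $\{X^I_t\vee X^N_t\}_{t\in T}$ are equal in distribution, and: (i) The decomposition is unique in distribution: if $\{g_t\}_{t\in T}\subset L_+^\alpha(S_{J,K},\lambda_{J,K})$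 is another minimal representation of $X$ with standardized support, then $J=I$ and $K=N$; and if $Y^I,Y^N$ are the processes built in the same way from $\{g_t\}$ and any random sup-measure with control measure $\lambda_{J,K}$, then $Y^I$ is equal in distribution to $X^I$ and $Y^N$ to $X^N$. (ii) The processes $X^I$ and $X^N$ are independent, and they have standardized supports $S_I$ and $S_N$, respectively. (iii) The restrictions $\{f_t|_{S_I}\}_{t\in T}\subset L_+^\alpha(S_I,\lambda_I)$ and $\{f_t|_{S_N}\}_{t\in T}\subset L_+^\alpha(S_N,\lambda_N)$ are minimal representations of $X^I$ and $X^N$, respectively. -/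

import Mathlib

open MeasureTheory ProbabilityTheory Filter Set
open scoped ENNReal NNReal

/-- The random variable `Z`, with values in `[0, ∞]`, is `α`-Fréchet with scale coefficient
`σ ∈ [0, ∞]`: `ℙ(Z ≤ x) = exp (- σ ^ α * x ^ (-α))` for all `x ∈ (0, ∞)`, where `exp (-∞) = 0`.
The degenerate cases are `Z = 0` almost surely (`σ = 0`) and `Z = ∞` almost surely (`σ = ∞`). -/
def IsFrechet {Ω : Type*} [MeasurableSpace Ω] (P : Measure Ω) (α : ℝ) (σ : ℝ≥0∞)
    (Z : Ω → ℝ≥0∞) : Prop :=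
  Measurable Z ∧ ∀ x : ℝ, 0 < x →
    P {ω | Z ω ≤ ENNReal.ofReal x} =
      EReal.exp (-((σ ^ α * ENNReal.ofReal (x ^ (-α)) : ℝ≥0∞) : EReal))

/-- The map that sends `ω` to the path `t ↦ X t ω`; the space of paths `T → ℝ` carries the
product `σ`-field. -/
def path {T Ω : Type*} (X : T → Ω → ℝ) : Ω → T → ℝ := fun ω t => X t ω

/-- Equality in distribution of two processes, that is, equality of their laws on the product
space `T → ℝ` (equivalently, of their finite-dimensional distributions). -/
def EqInDist {T Ω₁ Ω₂ : Type*} [MeasurableSpace Ω₁] [MeasurableSpace Ω₂]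
    (P₁ : Measure Ω₁) (P₂ : Measure Ω₂) (X : T → Ω₁ → ℝ) (Y : T → Ω₂ → ℝ) : Prop :=
  IdentDistrib (path X) (path Y) P₁ P₂

/-- An `α`-Fréchet process: a max-stable process with `α`-Fréchet marginals of finite scale
(scale `0` allowed). Max-stability: for every `n ≥ 1`, the pointwise maximum of `n` independent
copies of `X` has the law of `n ^ (1 / α) * X`. -/
def IsFrechetProcess {T Ω : Type*} [MeasurableSpace Ω] (α : ℝ) (P : Measure Ω)
    [IsProbabilityMeasure P] (X : T → Ω → ℝ) : Prop :=
  (∀ t, Measurable (X t)) ∧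
  (∀ t, ∀ᵐ ω ∂P, 0 ≤ X t ω) ∧
  (∀ t, ∃ σ : ℝ≥0∞, σ ≠ ∞ ∧ IsFrechet P α σ (fun ω => ENNReal.ofReal (X t ω))) ∧
  ∀ n : ℕ,
    (Measure.pi (fun _ : Fin (n + 1) => P.map (path X))).map
        (fun (y : Fin (n + 1) → T → ℝ) (t : T) => ⨆ i, y i t) =
      (P.map (path X)).map (fun (x : T → ℝ) (t : T) => ((n + 1 : ℕ) : ℝ) ^ (1 / α) * x t)

/-- `M` is an `α`-Fréchet random sup-measure with control measure `μ`. Its values lie in `[0, ∞]`,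
since `M A = ∞` almost surely when `μ A = ∞`. The value of `M` on non-measurable sets is
irrelevant. -/
structure IsRandomSupMeasure {S Ω : Type*} [MeasurableSpace S] [MeasurableSpace Ω]
    (α : ℝ) (P : Measure Ω) (μ : Measure S) (M : Set S → Ω → ℝ≥0∞) : Prop where
  indep : ∀ (n : ℕ) (A : Fin n → Set S), (∀ i, MeasurableSet (A i)) →
    Pairwise (fun i j => Disjoint (A i) (A j)) → iIndepFun (fun i => M (A i)) P
  frechet : ∀ A : Set S, MeasurableSet A → IsFrechet P α (μ A ^ (1 / α)) (M A)
  sup_additive : ∀ A : ℕ → Set S, (∀ i, MeasurableSet (A i)) →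
    Pairwise (fun i j => Disjoint (A i) (A j)) → ∀ᵐ ω ∂P, M (⋃ i, A i) ω = ⨆ i, M (A i) ω

/-- The space `L^α_+(S, μ)`. -/
def MemLPlus {S : Type*} [MeasurableSpace S] (α : ℝ) (μ : Measure S) (f : S → ℝ≥0) : Prop :=
  Measurable f ∧ ∫⁻ s, (f s : ℝ≥0∞) ^ α ∂μ < ∞

/-- The metric `∫ |f ^ α - g ^ α| dμ` of `L^α_+(S, μ)`. -/
noncomputable def rhoDist {S : Type*} [MeasurableSpace S] (α : ℝ) (μ : Measure S)
    (f g : S → ℝ≥0) : ℝ≥0∞ :=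
  ∫⁻ s, ENNReal.ofReal |(f s : ℝ) ^ α - (g s : ℝ) ^ α| ∂μ

/-- The extremal integral of a simple function `g = ∑ a 1_{g = a}`, namely the maximum of
`a * M {g = a}` over the values `a` of `g`. -/
noncomputable def simpleExtremalIntegral {S Ω : Type*} [MeasurableSpace S]
    (M : Set S → Ω → ℝ≥0∞) (g : SimpleFunc S ℝ≥0) (ω : Ω) : ℝ≥0∞ :=
  g.range.sup (fun a => (a : ℝ≥0∞) * M (g ⁻¹' {a}) ω)

/-- The random variable `ξ` is a version of the extremal integral of `f` with respect to `M`: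
it is the limit in probability of the extremal integrals of simple functions that converge to `f`
in `L^α_+(S, μ)`. -/
def IsExtremalIntegral {S Ω : Type*} [MeasurableSpace S] [MeasurableSpace Ω]
    (α : ℝ) (P : Measure Ω) (μ : Measure S) (M : Set S → Ω → ℝ≥0∞) (f : S → ℝ≥0)
    (ξ : Ω → ℝ) : Prop :=
  Measurable ξ ∧ ∃ g : ℕ → SimpleFunc S ℝ≥0,
    (∀ n, MemLPlus α μ (g n)) ∧
    Tendsto (fun n => rhoDist α μ (g n) f) atTop (nhds 0) ∧
    TendstoInMeasure P (fun n ω => (simpleExtremalIntegral M (g n) ω).toReal) atTop ξ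

open Classical in
/-- The extremal integral of `f` with respect to `M` (a version of it; the value `0` is only used
when no version exists). -/
noncomputable def extremalIntegral {S Ω : Type*} [MeasurableSpace S] [MeasurableSpace Ω]
    (α : ℝ) (P : Measure Ω) (μ : Measure S) (M : Set S → Ω → ℝ≥0∞) (f : S → ℝ≥0) : Ω → ℝ :=
  if h : ∃ ξ : Ω → ℝ, IsExtremalIntegral α P μ M f ξ then h.choose else 0

/-- The functions `f t` form a spectral representation of `X` over `L^α_+(S, μ)`: they lie in that
space, and `X` equals in distribution the process of their extremal integrals with respect to some
`α`-Fréchet random sup-measure with control measure `μ`. -/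
def IsSpectralRepresentation {T Ω : Type*} {S : Type} [MeasurableSpace S] [MeasurableSpace Ω]
    (α : ℝ) (P : Measure Ω) (X : T → Ω → ℝ) (μ : Measure S) (f : T → S → ℝ≥0) : Prop :=
  (∀ t, MemLPlus α μ (f t)) ∧
  ∃ (Ω₀ : Type) (_ : MeasurableSpace Ω₀) (P₀ : Measure Ω₀) (_ : IsProbabilityMeasure P₀)
    (M : Set S → Ω₀ → ℝ≥0∞), IsRandomSupMeasure α P₀ μ M ∧
      EqInDist P P₀ X (fun t => extremalIntegral α P₀ μ M (f t))

/-- The closed max-linear span of the `f t`: the closure in `L^α_+(S, μ)` of the set of the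
max-linear combinations of finitely many (at least one) of them with positive coefficients. -/
def closedMaxSpan {T S : Type*} [MeasurableSpace S] (α : ℝ) (μ : Measure S)
    (f : T → S → ℝ≥0) : Set (S → ℝ≥0) :=
  {h | MemLPlus α μ h ∧ ∀ ε : ℝ≥0∞, 0 < ε →
    ∃ (J : Finset T) (a : T → ℝ≥0), J.Nonempty ∧ (∀ t ∈ J, 0 < a t) ∧
      rhoDist α μ (fun s => J.sup (fun t => a t * f t s)) h < ε}

/-- The ratio `σ`-field: it is generated by the ratios `f t / f u`, with values in `[0, ∞]`
(with `c / 0 = ∞` for `c > 0`, and `0 / 0 = 0`). -/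
@[reducible] noncomputable def ratioSigmaField {T S : Type*} (f : T → S → ℝ≥0) : MeasurableSpace S :=
  ⨆ (t : T) (u : T),
    MeasurableSpace.comap (fun s => (f t s : ℝ≥0∞) / (f u s : ℝ≥0∞)) inferInstance

/-- A minimal spectral representation of `X`. A function of the closed max-linear span that is
nonzero almost everywhere is in particular a function of full support, so that `full_support` says
that the support of the family is `S` up to a null set. -/
structure IsMinimalRepresentation {T Ω : Type*} {S : Type} [mS : MeasurableSpace S]
    [MeasurableSpace Ω] (α : ℝ) (P : Measure Ω) (X : T → Ω → ℝ) (μ : Measure S)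
    (f : T → S → ℝ≥0) : Prop where
  spectral : IsSpectralRepresentation α P X μ f
  full_support : ∃ f₀ ∈ closedMaxSpan α μ f, μ {s | f₀ s = 0} = 0
  ratio : ∀ B : Set S, MeasurableSet[mS] B →
    ∃ A : Set S, MeasurableSet[ratioSigmaField f] A ∧ μ (symmDiff A B) = 0

/-- The set `S_{I,N}`: the interval `(0,1)` if `I = true` and the integers `1, …, N`
(all positive integers if `N = ∞`, none if `N = 0`). -/
def stdSet (I : Bool) (N : ℕ∞) : Set ℝ :=
  {x | I = true ∧ x ∈ Ioo (0 : ℝ) 1} ∪ {x | ∃ n : ℕ, 1 ≤ n ∧ (n : ℕ∞) ≤ N ∧ x = (n : ℝ)}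

/-- The space `S_{I,N}`, with its Borel `σ`-field. -/
abbrev StdSpace (I : Bool) (N : ℕ∞) : Type := ↥(stdSet I N)

/-- The measure `λ_{I,N}`: Lebesgue measure on `(0,1)` and counting measure on the integers. -/
noncomputable def stdMeasure (I : Bool) (N : ℕ∞) : Measure (StdSpace I N) :=
  Measure.comap Subtype.val
    ((volume : Measure ℝ).restrict (Ioo 0 1) +
      Measure.count.restrict (Set.range (fun n : ℕ => (n : ℝ))))

/-- The continuous part `S_I = S_{I,N} ∩ (0,1)`, which is `S_{I,0}`. -/
theorem stdSet_inter_Ioo (I : Bool) (N : ℕ∞) : stdSet I N ∩ Ioo 0 1 = stdSet I 0 := by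
  ext x
  constructor
  · rintro ⟨h | ⟨n, hn, -, rfl⟩, hx⟩
    · exact Or.inl h
    · have h1 : (1 : ℝ) ≤ n := by exact_mod_cast hn
      exact absurd hx.2 (not_lt.mpr h1)
  · rintro (h | ⟨n, hn, h0, -⟩)
    · exact ⟨Or.inl h, h.2⟩
    · have h2 : n = 0 := by simpa using h0
      omega

/-- The discrete part `S_N = S_{I,N} ∩ ℕ`, which is `S_{0,N}`. -/
theorem stdSet_inter_range (I : Bool) (N : ℕ∞) :
    stdSet I N ∩ Set.range (fun n : ℕ => (n : ℝ)) = stdSet false N := by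
  ext x
  constructor
  · rintro ⟨h | h, ⟨m, hm⟩⟩
    · exfalso
      obtain ⟨h1, h2⟩ := h.2
      simp only at hm
      rw [← hm] at h1 h2
      have h3 : 0 < m := by exact_mod_cast h1
      have h4 : m < 1 := by exact_mod_cast h2
      omega
    · exact Or.inr h
  · rintro (h | ⟨n, hn, hN, rfl⟩)
    · exact absurd h.1 (by simp)
    · exact ⟨Or.inr ⟨n, hn, hN, rfl⟩, ⟨n, rfl⟩⟩

/-- The continuous part, as a subset of the space `S_{I,N}`. -/
def contPart (I : Bool) (N : ℕ∞) : Set (StdSpace I N) := {s | (s : ℝ) ∈ Ioo (0 : ℝ) 1}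

/-- The discrete part, as a subset of the space `S_{I,N}`. -/
def discPart (I : Bool) (N : ℕ∞) : Set (StdSpace I N) :=
  {s | (s : ℝ) ∈ Set.range (fun n : ℕ => (n : ℝ))}

/-- The restrictions of the functions `f t` to the space `S_I = S_{I,0}`. -/
def restrictCont {T : Type*} {I : Bool} {N : ℕ∞} (f : T → StdSpace I N → ℝ≥0) :
    T → StdSpace I 0 → ℝ≥0 :=
  fun t s => f t ⟨s, ((stdSet_inter_Ioo I N).symm.subset s.2).1⟩

/-- The restrictions of the functions `f t` to the space `S_N = S_{0,N}`. -/
def restrictDisc {T : Type*} {I : Bool} {N : ℕ∞} (f : T → StdSpace I N → ℝ≥0) :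
    T → StdSpace false N → ℝ≥0 :=
  fun t s => f t ⟨s, ((stdSet_inter_range I N).symm.subset s.2).1⟩

/-- The process `X^I`, the extremal integrals of the functions `f t` over the continuous part. -/
noncomputable def contComponent {T Ω : Type*} [MeasurableSpace Ω] {I : Bool} {N : ℕ∞} (α : ℝ)
    (P : Measure Ω) (M : Set (StdSpace I N) → Ω → ℝ≥0∞) (f : T → StdSpace I N → ℝ≥0) :
    T → Ω → ℝ :=
  fun t => extremalIntegral α P (stdMeasure I N) M ((contPart I N).indicator (f t))

/-- The process `X^N`, the extremal integrals of the functions `f t` over the discrete part. -/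
noncomputable def discComponent {T Ω : Type*} [MeasurableSpace Ω] {I : Bool} {N : ℕ∞} (α : ℝ)
    (P : Measure Ω) (M : Set (StdSpace I N) → Ω → ℝ≥0∞) (f : T → StdSpace I N → ℝ≥0) :
    T → Ω → ℝ :=
  fun t => extremalIntegral α P (stdMeasure I N) M ((discPart I N).indicator (f t))

/-- The process `X` has standardized support `S_{I,N}`: it has a minimal representation over
`L^α_+(S_{I,N}, λ_{I,N})`, and every minimal representation of `X` over one of the standard
spaces is over that space. -/
def HasStandardizedSupport {T Ω : Type*} [MeasurableSpace Ω] (α : ℝ) (P : Measure Ω)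
    (X : T → Ω → ℝ) (I : Bool) (N : ℕ∞) : Prop :=
  (∃ f : T → StdSpace I N → ℝ≥0, IsMinimalRepresentation α P X (stdMeasure I N) f) ∧
  ∀ (J : Bool) (K : ℕ∞) (g : T → StdSpace J K → ℝ≥0),
    IsMinimalRepresentation α P X (stdMeasure J K) g → J = I ∧ K = N

/-! Everything reduces to the exponent of the family, `L s = ∫ (max_{(t,c) ∈ s} c f_t) ^ α dμ`. The
extremal integral is max-linear, so the event that `c X_t ≤ 1` for all `(t, c) ∈ s` has probability
`exp (-L s)`. These events determine the law of a nonnegative process. Hence the law depends on `f`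
and `μ` only through `L`, whatever the random sup-measure. Equality in distribution is equality of
exponents (`HasExponent.eqInDist`, `HasExponent.exponent_eq`), max-stability is homogeneity of `L`,
and independence over disjoint supports is additivity of `L`. To reach the extremal integral,
defined as a limit in probability, it is identified almost surely with `sup_q q M{f > q}`, `q`
rational, which commutes with countable suprema.

Uniqueness rests on the atoms. A right derivative of `L` in the coefficient of `f_{t₀}` recovers the
law of the ratios `(f_t / f_{t₀})_t` under the finite measure `f_{t₀} ^ α dμ`
(`tendsto_exponent_sub_exponent`). By minimality the ratios generate all measurable sets modulo null
sets. An atom of one representation therefore corresponds to a set of the other on which the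
weighted measure takes only the values `0` and full mass, and countable separation concentrates that
mass at one point (`exists_matching_atom`). Since integers carry mass exactly `1`, the vectors
`(f_t(n))_t` and `(g_t(m))_t` at matched integers are equal, not merely proportional. Minimality
makes distinct integers carry distinct vectors, so both discrete parts are enumerated by the same
set of vectors. This gives `K = N` and equal discrete exponents. The continuous exponents agree by
subtraction, and full support shows that the continuous exponent vanishes exactly when the interval
is absent, so `J = I`.

Minimality passes to the restriction to a measurable part of the space
(`IsMinimalRepresentation.comp_embedding`), and uniqueness applied to the restrictions yields the
standardized supports of the components. -/

/-! ### The function `a ↦ exp (-a)` on `[0, ∞]` -/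

/-- The function `a ↦ exp (-a)` on `[0, ∞]`. -/
noncomputable def expNeg (a : ℝ≥0∞) : ℝ≥0∞ := EReal.exp (-(a : EReal))

theorem expNeg_strictAnti : StrictAnti expNeg := fun _ _ h =>
  EReal.exp_strictMono (EReal.neg_lt_neg_iff.2 (EReal.coe_ennreal_lt_coe_ennreal_iff.2 h))

theorem expNeg_zero : expNeg 0 = 1 := by simp [expNeg]

theorem expNeg_le_one (a : ℝ≥0∞) : expNeg a ≤ 1 :=
  expNeg_zero ▸ expNeg_strictAnti.antitone zero_le

theorem expNeg_add (a b : ℝ≥0∞) : expNeg (a + b) = expNeg a * expNeg b := by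
  rw [expNeg, EReal.coe_ennreal_add, EReal.neg_add, sub_eq_add_neg, EReal.exp_add]
  · rfl
  · simp
  · simp

theorem expNeg_sum {ι : Type*} (s : Finset ι) (a : ι → ℝ≥0∞) :
    expNeg (∑ i ∈ s, a i) = ∏ i ∈ s, expNeg (a i) := by
  classical
  induction s using Finset.induction_on with
  | empty => simp [expNeg_zero]
  | insert i s hi ih => rw [Finset.sum_insert hi, Finset.prod_insert hi, expNeg_add, ih]

theorem continuous_expNeg : Continuous expNeg := by
  have h : StrictMono EReal.exp := EReal.exp_strictMono
  exact (h.monotone.continuous_of_surjective EReal.expOrderIso.surjective).comp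
    (continuous_neg.comp continuous_coe_ennreal_ereal)

theorem one_le_expNeg_add (a : ℝ≥0∞) : 1 ≤ expNeg a + a := by
  induction a with
  | top => simp
  | coe a =>
    have h : expNeg a = ENNReal.ofReal (Real.exp (-(a : ℝ))) := by
      rw [expNeg, ← EReal.exp_coe]; rfl
    rw [h, ← ENNReal.ofReal_coe_nnreal, ← ENNReal.ofReal_add (Real.exp_nonneg _) a.coe_nonneg,
      ← ENNReal.ofReal_one]
    exact ENNReal.ofReal_le_ofReal (by linarith [Real.add_one_le_exp (-(a : ℝ))])

/-- A Lipschitz bound, free of subtraction so that it covers `∞`. It converts distances between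
integrands into bounds on probabilities. -/
theorem expNeg_le_expNeg_add_add (a b : ℝ≥0∞) : expNeg a ≤ expNeg (a + b) + b := by
  calc expNeg a = expNeg a * 1 := (mul_one _).symm
    _ ≤ expNeg a * (expNeg b + b) := by gcongr; exact one_le_expNeg_add b
    _ = expNeg (a + b) + expNeg a * b := by rw [mul_add, expNeg_add]
    _ ≤ expNeg (a + b) + 1 * b := by gcongr; exact expNeg_le_one a
    _ = _ := by rw [one_mul]

/-! ### Random sup-measures -/

theorem IsFrechet.measure_le {Ω : Type*} [MeasurableSpace Ω] {P : Measure Ω} {α : ℝ}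
    {σ : ℝ≥0∞} {Z : Ω → ℝ≥0∞} (h : IsFrechet P α σ Z) {x : ℝ≥0} (hx : 0 < x) :
    P {ω | Z ω ≤ x} = expNeg (σ ^ α * (x : ℝ≥0∞) ^ (-α)) := by
  have := h.2 x hx
  rw [ENNReal.ofReal_coe_nnreal] at this
  rw [this, expNeg, ENNReal.ofReal_rpow_of_pos (by exact_mod_cast hx) |>.symm,
    ENNReal.ofReal_coe_nnreal]

namespace IsRandomSupMeasure

variable {S Ω : Type*} [MeasurableSpace S] [MeasurableSpace Ω] {α : ℝ} {P : Measure Ω}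
  {μ : Measure S} {M : Set S → Ω → ℝ≥0∞}

theorem measurable (hM : IsRandomSupMeasure α P μ M) {A : Set S} (hA : MeasurableSet A) :
    Measurable (M A) := (hM.frechet A hA).1

theorem measure_le (hM : IsRandomSupMeasure α P μ M) (hα : 0 < α) {A : Set S}
    (hA : MeasurableSet A) {x : ℝ≥0} (hx : 0 < x) :
    P {ω | M A ω ≤ x} = expNeg (μ A * (x : ℝ≥0∞) ^ (-α)) := by
  rw [(hM.frechet A hA).measure_le hx, ← ENNReal.rpow_mul, one_div, inv_mul_cancel₀ hα.ne',
    ENNReal.rpow_one]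

theorem empty (hM : IsRandomSupMeasure α P μ M) (hα : 0 < α) [IsProbabilityMeasure P] :
    ∀ᵐ ω ∂P, M ∅ ω = 0 := by
  -- The Fréchet law is prescribed only at positive levels, so the value `0` is reached through the
  -- levels `1 / (n + 1)`.
  have h : ∀ n : ℕ, ∀ᵐ ω ∂P, M ∅ ω ≤ ((1 / ((n : ℝ≥0) + 1) : ℝ≥0) : ℝ≥0∞) := fun n => by
    have h1 := hM.measure_le hα MeasurableSet.empty (x := 1 / ((n : ℝ≥0) + 1)) (by positivity)
    rw [measure_empty, zero_mul, expNeg_zero] at h1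
    exact (prob_compl_eq_zero_iff
      (measurableSet_le (hM.measurable MeasurableSet.empty) measurable_const)).2 h1
  filter_upwards [ae_all_iff.2 h] with ω hω
  by_contra h0
  obtain ⟨n, hn⟩ := ENNReal.exists_inv_nat_lt h0
  refine (hω n).not_gt (lt_of_le_of_lt ?_ hn)
  rw [ENNReal.coe_div (by positivity), ENNReal.coe_one, one_div]
  exact ENNReal.inv_le_inv.2 (by push_cast; exact le_self_add)

theorem union_of_disjoint (hM : IsRandomSupMeasure α P μ M) (hα : 0 < α)
    [IsProbabilityMeasure P] {A B : Set S} (hA : MeasurableSet A) (hB : MeasurableSet B)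
    (hAB : Disjoint A B) : ∀ᵐ ω ∂P, M (A ∪ B) ω = M A ω ⊔ M B ω := by
  -- Sup-additivity is given for sequences; padding with empty sets is harmless because `M ∅ = 0`
  -- almost surely.
  set C : ℕ → Set S := fun n => if n = 0 then A else if n = 1 then B else ∅ with hC
  have h := hM.sup_additive C (fun i => by simp only [hC]; split_ifs <;> simp [*]) (by
    intro i j hij
    simp only [hC]
    split_ifs <;> simp_all [disjoint_comm])
  have hU : ⋃ i, C i = A ∪ B := by
    ext x
    simp only [mem_iUnion, mem_union]
    constructor
    · rintro ⟨i, hi⟩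
      simp only [hC] at hi
      split_ifs at hi with h1 h2
      · exact Or.inl hi
      · exact Or.inr hi
      · exact hi.elim
    · rintro (hx | hx)
      · exact ⟨0, by simpa [hC] using hx⟩
      · exact ⟨1, by simpa [hC] using hx⟩
  rw [hU] at h
  filter_upwards [h, hM.empty hα] with ω hω h0
  rw [hω]
  apply le_antisymm
  · refine iSup_le fun i => ?_
    simp only [hC]
    split_ifs
    · exact le_sup_left
    · exact le_sup_right
    · rw [h0]; exact zero_le
  · exact sup_le (le_iSup_of_le 0 (by simp [hC])) (le_iSup_of_le 1 (by simp [hC]))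

theorem mono (hM : IsRandomSupMeasure α P μ M) (hα : 0 < α)
    [IsProbabilityMeasure P] {A B : Set S} (hA : MeasurableSet A) (hB : MeasurableSet B)
    (hAB : A ⊆ B) : ∀ᵐ ω ∂P, M A ω ≤ M B ω := by
  have h := hM.union_of_disjoint hα hA (hB.diff hA) disjoint_sdiff_right
  rw [union_sdiff_cancel hAB] at h
  filter_upwards [h] with ω hω
  rw [hω]
  exact le_sup_left

theorem iUnion (hM : IsRandomSupMeasure α P μ M) (hα : 0 < α)
    [IsProbabilityMeasure P] {A : ℕ → Set S} (hA : ∀ i, MeasurableSet (A i)) :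
    ∀ᵐ ω ∂P, M (⋃ i, A i) ω = ⨆ i, M (A i) ω := by
  have h := hM.sup_additive (disjointed A) (fun i => MeasurableSet.disjointed hA i)
    (disjoint_disjointed A)
  rw [iUnion_disjointed] at h
  filter_upwards [h,
    ae_all_iff.2 fun i => hM.mono hα (MeasurableSet.disjointed hA i) (hA i) (disjointed_subset A i),
    ae_all_iff.2 fun i => hM.mono hα (hA i) (MeasurableSet.iUnion hA) (subset_iUnion A i)]
    with ω h1 h2 h3
  exact le_antisymm (h1.le.trans (iSup_mono h2)) (iSup_le h3)

theorem iUnion_countable (hM : IsRandomSupMeasure α P μ M) (hα : 0 < α)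
    [IsProbabilityMeasure P] {ι : Type*} [Countable ι] {A : ι → Set S}
    (hA : ∀ i, MeasurableSet (A i)) : ∀ᵐ ω ∂P, M (⋃ i, A i) ω = ⨆ i, M (A i) ω := by
  rcases isEmpty_or_nonempty ι with hι | hι
  · simpa using hM.empty hα
  · obtain ⟨φ, hφ⟩ := exists_surjective_nat ι
    have h := hM.iUnion hα (fun n => hA (φ n))
    rw [hφ.iUnion_comp A] at h
    filter_upwards [h] with ω hω
    rw [hω]
    exact hφ.iSup_comp (fun i => M (A i) ω)

end IsRandomSupMeasure

/-! ### A canonical version of the extremal integral -/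

theorem ENNReal.lt_iff_exists_nnrat_btwn {a b : ℝ≥0∞} :
    a < b ↔ ∃ q : ℚ≥0, a < ((q : ℝ≥0) : ℝ≥0∞) ∧ ((q : ℝ≥0) : ℝ≥0∞) < b := by
  refine ⟨fun h => ?_, fun ⟨q, h1, h2⟩ => h1.trans h2⟩
  obtain ⟨q, hq, h1, h2⟩ := ENNReal.lt_iff_exists_rat_btwn.1 h
  let p : ℚ≥0 := ⟨q, hq⟩
  have h3 : (q : ℝ).toNNReal = (p : ℝ≥0) := by
    ext
    rw [Real.coe_toNNReal _ (by exact_mod_cast hq)]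
    rfl
  rw [h3] at h1 h2
  exact ⟨_, h1, h2⟩

theorem ENNReal.iSup_nnrat_lt (r : ℝ≥0∞) :
    ⨆ q : {q : ℚ≥0 // ((q : ℝ≥0) : ℝ≥0∞) < r}, (((q : ℚ≥0) : ℝ≥0) : ℝ≥0∞) = r := by
  refine le_antisymm (iSup_le fun q => q.2.le) (le_of_forall_lt fun a ha => ?_)
  obtain ⟨q, h1, h2⟩ := ENNReal.lt_iff_exists_nnrat_btwn.1 ha
  exact h1.trans_le (le_iSup (fun q : {q : ℚ≥0 // ((q : ℝ≥0) : ℝ≥0∞) < r} =>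
    (((q : ℚ≥0) : ℝ≥0) : ℝ≥0∞)) ⟨q, h2⟩)

/-- The supremum of `q * M {f > q}` over the rational `q ≥ 0`. It is an everywhere defined version
of the extremal integral of `f`. -/
noncomputable def supIntegral {S Ω : Type*} (M : Set S → Ω → ℝ≥0∞) (f : S → ℝ≥0∞) (ω : Ω) :
    ℝ≥0∞ :=
  ⨆ q : ℚ≥0, ((q : ℝ≥0) : ℝ≥0∞) * M {s | ((q : ℝ≥0) : ℝ≥0∞) < f s} ω

namespace IsRandomSupMeasure

variable {S Ω : Type*} [MeasurableSpace S] [MeasurableSpace Ω] {α : ℝ} {P : Measure Ω}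
  {μ : Measure S} {M : Set S → Ω → ℝ≥0∞}

theorem measurable_supIntegral (hM : IsRandomSupMeasure α P μ M) {f : S → ℝ≥0∞}
    (hf : Measurable f) : Measurable (supIntegral M f) :=
  Measurable.iSup fun _ =>
    (hM.measurable (measurableSet_lt measurable_const hf)).const_mul _

/-- Strict level sets turn suprema into unions, `{sup_i f_i > q} = ⋃ {f_i > q}`, and countability of
the rational levels leaves a single null set. -/
theorem supIntegral_iSup (hM : IsRandomSupMeasure α P μ M) (hα : 0 < α)
    [IsProbabilityMeasure P] {ι : Type*} [Countable ι] {f : ι → S → ℝ≥0∞}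
    (hf : ∀ i, Measurable (f i)) :
    ∀ᵐ ω ∂P, supIntegral M (fun s => ⨆ i, f i s) ω = ⨆ i, supIntegral M (f i) ω := by
  filter_upwards [ae_all_iff.2 fun q : ℚ≥0 => hM.iUnion_countable hα
    (A := fun i => {s | ((q : ℝ≥0) : ℝ≥0∞) < f i s})
    (fun i => measurableSet_lt measurable_const (hf i))] with ω hω
  simp only [supIntegral]
  rw [iSup_comm]
  refine iSup_congr fun q => ?_
  rw [← ENNReal.mul_iSup, ← hω q]
  congr 2
  ext s
  simp [lt_iSup_iff]

theorem supIntegral_finset_sup (hM : IsRandomSupMeasure α P μ M) (hα : 0 < α)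
    [IsProbabilityMeasure P] {ι : Type*} (s : Finset ι) {f : ι → S → ℝ≥0∞}
    (hf : ∀ i, Measurable (f i)) :
    ∀ᵐ ω ∂P, supIntegral M (fun x => s.sup (fun i => f i x)) ω =
      s.sup fun i => supIntegral M (f i) ω := by
  filter_upwards [hM.supIntegral_iSup hα (fun i : s => hf i)] with ω hω
  simp only [Finset.sup_eq_iSup]
  simpa only [iSup_subtype'] using hω

theorem supIntegral_sup (hM : IsRandomSupMeasure α P μ M) (hα : 0 < α)
    [IsProbabilityMeasure P] {f g : S → ℝ≥0∞} (hf : Measurable f) (hg : Measurable g) :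
    ∀ᵐ ω ∂P, supIntegral M (fun s => f s ⊔ g s) ω = supIntegral M f ω ⊔ supIntegral M g ω := by
  have := hM.supIntegral_iSup hα (f := fun b : Bool => bif b then f else g)
    (fun b => by cases b <;> assumption)
  simpa only [iSup_bool_eq, cond_true, cond_false] using this

/-- Irrational levels are needed for homogeneity: multiplication of `f` by `c` replaces the level
`q` by `q / c`. They are approached by rational levels from below. -/
theorem mul_le_supIntegral (hM : IsRandomSupMeasure α P μ M) (hα : 0 < α)
    [IsProbabilityMeasure P] {f : S → ℝ≥0∞} (hf : Measurable f) (r : ℝ≥0∞) :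
    ∀ᵐ ω ∂P, r * M {s | r < f s} ω ≤ supIntegral M f ω := by
  filter_upwards [ae_all_iff.2 fun q : {q : ℚ≥0 // ((q : ℝ≥0) : ℝ≥0∞) < r} =>
    hM.mono hα (measurableSet_lt measurable_const hf) (measurableSet_lt measurable_const hf)
      (fun (s : S) (hs : r < f s) => q.2.trans hs)] with ω hω
  nth_rw 1 [← ENNReal.iSup_nnrat_lt r]
  rw [ENNReal.iSup_mul]
  refine iSup_le fun q => ?_
  exact (mul_le_mul_right (hω q) _).trans (le_iSup
    (fun q : ℚ≥0 => ((q : ℝ≥0) : ℝ≥0∞) * M {s | ((q : ℝ≥0) : ℝ≥0∞) < f s} ω) q.1)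

theorem supIntegral_const_mul_le (hM : IsRandomSupMeasure α P μ M) (hα : 0 < α)
    [IsProbabilityMeasure P] {f : S → ℝ≥0∞} (hf : Measurable f) {c : ℝ≥0} (hc : c ≠ 0) :
    ∀ᵐ ω ∂P, supIntegral M (fun s => c * f s) ω ≤ c * supIntegral M f ω := by
  have hc' : (c : ℝ≥0∞) ≠ 0 := by simpa using hc
  filter_upwards [ae_all_iff.2 fun q : ℚ≥0 => hM.mul_le_supIntegral hα hf ((q : ℝ≥0) / c)]
    with ω hω
  refine iSup_le fun q => ?_
  have h : {s | ((q : ℝ≥0) : ℝ≥0∞) < c * f s} = {s | ((q : ℝ≥0) : ℝ≥0∞) / c < f s} := by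
    ext s
    simp only [mem_ofPred_eq]
    rw [ENNReal.div_lt_iff (Or.inl hc') (Or.inl ENNReal.coe_ne_top), mul_comm]
  rw [h]
  calc _ = c * (((q : ℝ≥0) : ℝ≥0∞) / c * M {s | ((q : ℝ≥0) : ℝ≥0∞) / c < f s} ω) := by
        rw [← mul_assoc, ENNReal.mul_div_cancel hc' ENNReal.coe_ne_top]
    _ ≤ _ := mul_le_mul_right (hω q) _

theorem supIntegral_const_mul (hM : IsRandomSupMeasure α P μ M) (hα : 0 < α)
    [IsProbabilityMeasure P] {f : S → ℝ≥0∞} (hf : Measurable f) (c : ℝ≥0) :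
    ∀ᵐ ω ∂P, supIntegral M (fun s => c * f s) ω = c * supIntegral M f ω := by
  rcases eq_or_ne c 0 with rfl | hc
  · filter_upwards [hM.empty hα] with ω hω
    simp [supIntegral, hω]
  · have hc' : (c : ℝ≥0∞) ≠ 0 := by simpa using hc
    -- The reverse inequality is the same bound for the constant `c⁻¹` and the function `c * f`.
    filter_upwards [hM.supIntegral_const_mul_le hα hf hc,
      hM.supIntegral_const_mul_le hα (hf.const_mul (c : ℝ≥0∞)) (inv_ne_zero hc)] with ω h1 h2
    refine le_antisymm h1 ?_
    have h3 : (fun s => ((c⁻¹ : ℝ≥0) : ℝ≥0∞) * (c * f s)) = f := by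
      ext s
      rw [← mul_assoc, ← ENNReal.coe_mul, inv_mul_cancel₀ hc, ENNReal.coe_one, one_mul]
    rw [h3] at h2
    calc _ ≤ (c : ℝ≥0∞) * (((c⁻¹ : ℝ≥0) : ℝ≥0∞) * supIntegral M (fun s => c * f s) ω) :=
          mul_le_mul_right h2 _
      _ = _ := by rw [← mul_assoc, ← ENNReal.coe_mul, mul_inv_cancel₀ hc, ENNReal.coe_one, one_mul]

theorem measurable_simpleExtremalIntegral (hM : IsRandomSupMeasure α P μ M)
    (g : SimpleFunc S ℝ≥0) : Measurable (simpleExtremalIntegral M g) := by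
  have h : simpleExtremalIntegral M g =
      fun ω => ⨆ a ∈ (g.range : Set ℝ≥0), (a : ℝ≥0∞) * M (g ⁻¹' {a}) ω := by
    ext ω
    simp [simpleExtremalIntegral, Finset.sup_eq_iSup]
  rw [h]
  exact Measurable.biSup _ g.range.countable_toSet fun a _ =>
    (hM.measurable (g.measurableSet_preimage _)).const_mul _

/-- `{g > q}` is the finite union of the sets `{g = a}` with `a > q`, and for fixed `a` the supremum
of the rationals `q < a` is `a`. -/
theorem supIntegral_simpleFunc (hM : IsRandomSupMeasure α P μ M) (hα : 0 < α)
    [IsProbabilityMeasure P] (g : SimpleFunc S ℝ≥0) :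
    ∀ᵐ ω ∂P, supIntegral M (fun s => (g s : ℝ≥0∞)) ω = simpleExtremalIntegral M g ω := by
  filter_upwards [ae_all_iff.2 fun q : ℚ≥0 => hM.iUnion_countable hα
    (A := fun a : {a : g.range // (q : ℝ≥0) < (a : ℝ≥0)} => g ⁻¹' {(a.1 : ℝ≥0)})
    (fun i => g.measurableSet_preimage _)] with ω hω
  have h : ∀ q : ℚ≥0, {s | ((q : ℝ≥0) : ℝ≥0∞) < g s} =
      ⋃ a : {a : g.range // (q : ℝ≥0) < (a : ℝ≥0)}, g ⁻¹' {(a.1 : ℝ≥0)} := by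
    intro q
    ext s
    simp
  simp only [supIntegral, simpleExtremalIntegral]
  simp_rw [h, hω]
  apply le_antisymm
  · refine iSup_le fun q => ?_
    rw [ENNReal.mul_iSup]
    refine iSup_le fun a => ?_
    calc _ ≤ ((a.1 : ℝ≥0) : ℝ≥0∞) * M (g ⁻¹' {(a.1 : ℝ≥0)}) ω :=
          mul_le_mul_left (ENNReal.coe_le_coe.2 a.2.le) _
      _ ≤ _ := Finset.le_sup (f := fun a : ℝ≥0 => (a : ℝ≥0∞) * M (g ⁻¹' {a}) ω) a.1.2
  · refine Finset.sup_le fun a ha => ?_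
    conv_lhs => rw [← ENNReal.iSup_nnrat_lt (a : ℝ≥0∞)]
    rw [ENNReal.iSup_mul]
    refine iSup_le fun q => le_iSup_of_le q.1 ?_
    refine mul_le_mul_right ?_ _
    exact le_iSup (fun a : {a : g.range // ((q : ℚ≥0) : ℝ≥0) < (a : ℝ≥0)} =>
      M (g ⁻¹' {(a.1 : ℝ≥0)}) ω) ⟨⟨a, ha⟩, ENNReal.coe_lt_coe.1 q.2⟩

theorem measure_mul_le_one (hM : IsRandomSupMeasure α P μ M) (hα : 0 < α)
    [IsProbabilityMeasure P] {A : Set S} (hA : MeasurableSet A) (a : ℝ≥0) :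
    P {ω | (a : ℝ≥0∞) * M A ω ≤ 1} = expNeg ((a : ℝ≥0∞) ^ α * μ A) := by
  rcases eq_or_ne a 0 with rfl | ha
  · simp [ENNReal.zero_rpow_of_pos hα, expNeg_zero]
  · have ha' : (a : ℝ≥0∞) ≠ 0 := by simpa using ha
    have h := hM.measure_le hα hA (inv_pos.2 (pos_iff_ne_zero.2 ha))
    rw [ENNReal.coe_inv ha, ENNReal.inv_rpow, ENNReal.rpow_neg, inv_inv, mul_comm] at h
    rw [← h]
    congr 1
    ext ω
    simp only [mem_ofPred_eq]
    rw [mul_comm, ENNReal.le_inv_iff_mul_le]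

theorem measure_simpleExtremalIntegral_le_one (hM : IsRandomSupMeasure α P μ M) (hα : 0 < α)
    [IsProbabilityMeasure P] (g : SimpleFunc S ℝ≥0) :
    P {ω | simpleExtremalIntegral M g ω ≤ 1} = expNeg (∫⁻ s, (g s : ℝ≥0∞) ^ α ∂μ) := by
  set e := g.range.equivFin.symm with he
  have hind := hM.indep _ (fun i => g ⁻¹' {((e i : g.range) : ℝ≥0)})
    (fun i => g.measurableSet_preimage _) (by
      intro i j hij
      refine Disjoint.preimage _ (disjoint_singleton.2 fun h => hij ?_)
      exact e.injective (Subtype.ext h))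
  have h1 : {ω | simpleExtremalIntegral M g ω ≤ 1} =
      ⋂ i, {ω | ((e i : ℝ≥0) : ℝ≥0∞) * M (g ⁻¹' {((e i : g.range) : ℝ≥0)}) ω ≤ 1} := by
    ext ω
    simp only [simpleExtremalIntegral, mem_ofPred_eq, Finset.sup_le_iff, mem_iInter]
    refine ⟨fun h i => h _ (e i).2, fun h a ha => ?_⟩
    have := h (e.symm ⟨a, ha⟩)
    rwa [e.apply_symm_apply] at this
  -- Independence over the disjoint level sets gives a product of exponentials, whose exponents sum
  -- to the integral of `g ^ α`.
  rw [h1, hind.meas_iInter (fun i => ?_)]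
  · simp_rw [hM.measure_mul_le_one hα (g.measurableSet_preimage _)]
    rw [← expNeg_sum, e.sum_comp (fun a : g.range => ((a : ℝ≥0) : ℝ≥0∞) ^ α * μ (g ⁻¹' {(a : ℝ≥0)})),
      Finset.sum_coe_sort g.range (fun a => (a : ℝ≥0∞) ^ α * μ (g ⁻¹' {a})),
      ← SimpleFunc.map_lintegral (fun a : ℝ≥0 => (a : ℝ≥0∞) ^ α), ← SimpleFunc.lintegral_eq_lintegral]
    rfl
  · exact ⟨{z | ((e i : ℝ≥0) : ℝ≥0∞) * z ≤ 1},
      measurableSet_le (measurable_id.const_mul _) measurable_const, rfl⟩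

/-- A nondecreasing sequence of simple functions with supremum `f`. -/
noncomputable def _root_.nnrealApprox (f : S → ℝ≥0∞) (n : ℕ) : SimpleFunc S ℝ≥0 :=
  (SimpleFunc.eapprox f n).map ENNReal.toNNReal

theorem _root_.coe_nnrealApprox (f : S → ℝ≥0∞) (n : ℕ) (s : S) :
    (nnrealApprox f n s : ℝ≥0∞) = SimpleFunc.eapprox f n s :=
  ENNReal.coe_toNNReal (SimpleFunc.eapprox_lt_top f n s).ne

theorem _root_.iSup_coe_nnrealApprox {f : S → ℝ≥0∞} (hf : Measurable f) (s : S) :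
    ⨆ n, (nnrealApprox f n s : ℝ≥0∞) = f s := by
  simp_rw [coe_nnrealApprox, SimpleFunc.iSup_eapprox_apply hf]

theorem _root_.monotone_coe_nnrealApprox (f : S → ℝ≥0∞) :
    Monotone fun n s => (nnrealApprox f n s : ℝ≥0∞) := fun i j hij s => by
  simp only [coe_nnrealApprox]
  exact SimpleFunc.monotone_eapprox f hij s

theorem supIntegral_mono (hM : IsRandomSupMeasure α P μ M) (hα : 0 < α)
    [IsProbabilityMeasure P] {f g : S → ℝ≥0∞} (hf : Measurable f) (hg : Measurable g)
    (hfg : f ≤ g) : ∀ᵐ ω ∂P, supIntegral M f ω ≤ supIntegral M g ω := by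
  filter_upwards [hM.supIntegral_sup hα hf hg] with ω hω
  have h : (fun s => f s ⊔ g s) = g := funext fun s => sup_eq_right.2 (hfg s)
  rw [h] at hω
  rw [hω]
  exact le_sup_left

theorem supIntegral_nnrealApprox (hM : IsRandomSupMeasure α P μ M) (hα : 0 < α)
    [IsProbabilityMeasure P] {f : S → ℝ≥0∞} (hf : Measurable f) :
    ∀ᵐ ω ∂P, Monotone (fun n => simpleExtremalIntegral M (nnrealApprox f n) ω) ∧
      ⨆ n, simpleExtremalIntegral M (nnrealApprox f n) ω = supIntegral M f ω := by
  have hm : ∀ n, Measurable fun s => (nnrealApprox f n s : ℝ≥0∞) := fun n =>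
    (nnrealApprox f n).measurable.coe_nnreal_ennreal
  filter_upwards [hM.supIntegral_iSup hα hm,
    ae_all_iff.2 fun n => hM.supIntegral_simpleFunc hα (nnrealApprox f n),
    ae_all_iff.2 fun n => hM.supIntegral_mono hα (hm n) (hm (n + 1))
      (monotone_coe_nnrealApprox f n.le_succ)] with ω h1 h2 h3
  simp_rw [h2] at h1 h3
  refine ⟨monotone_nat_of_le_succ h3, ?_⟩
  rw [← h1]
  simp_rw [iSup_coe_nnrealApprox hf]

/-- The distribution function of the extremal integral, at `1`. -/
theorem measure_supIntegral_le_one (hM : IsRandomSupMeasure α P μ M) (hα : 0 < α)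
    [IsProbabilityMeasure P] {f : S → ℝ≥0∞} (hf : Measurable f) :
    P {ω | supIntegral M f ω ≤ 1} = expNeg (∫⁻ s, f s ^ α ∂μ) := by
  set ξ : ℕ → Ω → ℝ≥0∞ := fun n => simpleExtremalIntegral M (nnrealApprox f n) with hξ
  have hξm : ∀ n, Measurable (ξ n) := fun n => hM.measurable_simpleExtremalIntegral _
  have h1 : {ω | supIntegral M f ω ≤ 1} =ᵐ[P] ⋂ n, {ω | ξ n ω ≤ 1} := by
    filter_upwards [hM.supIntegral_nnrealApprox hα hf] with ω hω
    apply propext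
    change supIntegral M f ω ≤ 1 ↔ ω ∈ ⋂ n, {ω | ξ n ω ≤ 1}
    rw [← hω.2, iSup_le_iff, mem_iInter]
    rfl
  -- The `ξ n` increase only almost surely, so finite intersections provide honestly decreasing
  -- events; each agrees almost surely with its last term.
  have h2 : ∀ n, P (⋂ k ≤ n, {ω | ξ k ω ≤ 1}) = expNeg (∫⁻ s, (nnrealApprox f n s : ℝ≥0∞) ^ α ∂μ) := by
    intro n
    rw [← hM.measure_simpleExtremalIntegral_le_one hα]
    refine measure_congr ?_
    filter_upwards [hM.supIntegral_nnrealApprox hα hf] with ω hω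
    apply propext
    change ω ∈ ⋂ k ≤ n, {ω | ξ k ω ≤ 1} ↔ ξ n ω ≤ 1
    simp only [mem_iInter]
    exact ⟨fun h => h n le_rfl, fun h k hk => (hω.1 hk).trans h⟩
  have h3 : Tendsto (fun n => P (⋂ k ≤ n, {ω | ξ k ω ≤ 1})) atTop (nhds (P (⋂ n, {ω | ξ n ω ≤ 1}))) :=
    tendsto_measure_iInter_le
      (fun n => (measurableSet_le (hξm n) measurable_const).nullMeasurableSet)
      ⟨0, measure_ne_top _ _⟩
  rw [measure_congr h1]
  refine tendsto_nhds_unique h3 ?_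
  simp_rw [h2]
  refine (continuous_expNeg.tendsto _).comp ?_
  have h4 : ∀ s, ⨆ n, (nnrealApprox f n s : ℝ≥0∞) ^ α = f s ^ α := fun s => by
    rw [← iSup_coe_nnrealApprox hf s]
    exact ((ENNReal.orderIsoRpow α hα).map_iSup fun n => (nnrealApprox f n s : ℝ≥0∞)).symm
  have h5 : Monotone fun n s => (nnrealApprox f n s : ℝ≥0∞) ^ α := fun i j hij s =>
    ENNReal.rpow_le_rpow (monotone_coe_nnrealApprox f hij s) hα.le
  simp_rw [← h4]
  rw [lintegral_iSup (fun n => (nnrealApprox f n).measurable.coe_nnreal_ennreal.pow_const α) h5]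
  exact tendsto_atTop_iSup fun i j hij => lintegral_mono (h5 hij)

end IsRandomSupMeasure

/-! ### The extremal integral -/

/-- The laws control only the probability that a fixed level separates two integrals, and this
suffices. If `ξ < y < x < ζ`, then either `η n` is at distance at least `x - y` from `ξ`, or `η n ≤
x < ζ`; both events have vanishing probability. Rational levels exhaust `{ξ ≠ ζ}`. -/
theorem ae_eq_of_tendstoInMeasure_of_crossing {Ω : Type*} [MeasurableSpace Ω] {P : Measure Ω}
    {η : ℕ → Ω → ℝ} {ξ ζ : Ω → ℝ} (hη : TendstoInMeasure P η atTop ξ) (hζ : ∀ ω, 0 ≤ ζ ω)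
    (h1 : ∀ x : ℝ, x ≠ 0 → Tendsto (fun n => P {ω | η n ω ≤ x ∧ x < ζ ω}) atTop (nhds 0))
    (h2 : ∀ x : ℝ, 0 < x → Tendsto (fun n => P {ω | ζ ω ≤ x ∧ x < η n ω}) atTop (nhds 0)) :
    ξ =ᵐ[P] ζ := by
  have hη' := tendstoInMeasure_iff_dist.1 hη
  have k1 : ∀ x y : ℚ, (x : ℝ) ≠ 0 → y < x → ∀ᵐ ω ∂P, ¬ (ξ ω < y ∧ (x : ℝ) < ζ ω) := by
    intro x y hy hxy
    have hxy' : (y : ℝ) < x := by exact_mod_cast hxy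
    have h := (hη' (x - y) (by linarith)).add (h1 x hy)
    rw [add_zero] at h
    refine nonpos_iff_eq_zero.1 (ge_of_tendsto' h fun n => ?_)
    refine (measure_mono ?_).trans (measure_union_le _ _)
    intro ω hω
    have hω' : ξ ω < y ∧ (x : ℝ) < ζ ω := not_not.1 hω
    by_cases hc : η n ω ≤ x
    · exact Or.inr ⟨hc, hω'.2⟩
    · left
      change (x : ℝ) - y ≤ dist (η n ω) (ξ ω)
      rw [Real.dist_eq]
      refine le_trans ?_ (le_abs_self _)
      linarith [hω'.1]
  have k2 : ∀ x y : ℚ, 0 < (y : ℝ) → y < x → ∀ᵐ ω ∂P, ¬ (ζ ω < y ∧ (x : ℝ) < ξ ω) := by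
    intro x y hy hxy
    have hxy' : (y : ℝ) < x := by exact_mod_cast hxy
    have h := (hη' (x - y) (by linarith)).add (h2 y hy)
    rw [add_zero] at h
    refine nonpos_iff_eq_zero.1 (ge_of_tendsto' h fun n => ?_)
    refine (measure_mono ?_).trans (measure_union_le _ _)
    intro ω hω
    have hω' : ζ ω < y ∧ (x : ℝ) < ξ ω := not_not.1 hω
    by_cases hc : y < η n ω
    · exact Or.inr ⟨hω'.1.le, hc⟩
    · left
      change (x : ℝ) - y ≤ dist (η n ω) (ξ ω)
      rw [dist_comm, Real.dist_eq]
      refine le_trans ?_ (le_abs_self _)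
      linarith [hω'.2]
  simp only [← ae_all_iff] at k1 k2
  filter_upwards [k1, k2] with ω h1 h2
  apply le_antisymm
  · by_contra! hc
    obtain ⟨y, hy1, hy2⟩ := exists_rat_btwn hc
    obtain ⟨x, hx1, hx2⟩ := exists_rat_btwn hy2
    exact h2 x y ((hζ ω).trans_lt hy1) (by exact_mod_cast hx1) ⟨hy1, hx2⟩
  · by_contra! hc
    obtain ⟨y, hy1, hy2⟩ := exists_rat_btwn hc
    obtain ⟨x, hx1, hx2⟩ := exists_rat_btwn hy2
    -- No crossing bound is assumed at level `0`; a rational strictly between `0` and `ζ ω` replaces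
    -- it.
    rcases eq_or_ne (x : ℝ) 0 with h0 | h0
    · obtain ⟨z, hz1, hz2⟩ := exists_rat_btwn hx2
      exact h1 z y (by linarith) (by exact_mod_cast hx1.trans hz1) ⟨hy1, hz2⟩
    · exact h1 x y h0 (by exact_mod_cast hx1) ⟨hy1, hx2⟩

theorem tendsto_rpow_mul_zero {α : ℝ} (hα : 0 < α) (C : ℝ≥0∞) (hC : C ≠ ∞) :
    Tendsto (fun n : ℕ => ((((n : ℝ≥0) + 1)⁻¹ : ℝ≥0) : ℝ≥0∞) ^ α * C) atTop (nhds 0) := by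
  have h1 : Tendsto (fun n : ℕ => ((((n : ℝ≥0) + 1)⁻¹ : ℝ≥0) : ℝ≥0∞)) atTop (nhds 0) := by
    rw [← ENNReal.coe_zero, ENNReal.tendsto_coe]
    simpa only [one_div] using tendsto_one_div_add_atTop_nhds_zero_nat (𝕜 := ℝ≥0)
  have h2 := (ENNReal.continuous_rpow_const (y := α)).tendsto 0 |>.comp h1
  rw [ENNReal.zero_rpow_of_pos hα] at h2
  simpa using ENNReal.Tendsto.mul_const h2 (Or.inr hC)

namespace IsRandomSupMeasure

variable {S Ω : Type*} [MeasurableSpace S] [MeasurableSpace Ω] {α : ℝ} {P : Measure Ω}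
  {μ : Measure S} {M : Set S → Ω → ℝ≥0∞}

theorem measure_mul_supIntegral_le_one (hM : IsRandomSupMeasure α P μ M) (hα : 0 < α)
    [IsProbabilityMeasure P] {f : S → ℝ≥0∞} (hf : Measurable f) (c : ℝ≥0) :
    P {ω | c * supIntegral M f ω ≤ 1} = expNeg ((c : ℝ≥0∞) ^ α * ∫⁻ s, f s ^ α ∂μ) := by
  rw [← lintegral_const_mul _ (hf.pow_const α)]
  simp_rw [← ENNReal.mul_rpow_of_nonneg _ _ hα.le]
  rw [← hM.measure_supIntegral_le_one hα (hf.const_mul _)]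
  refine measure_congr ?_
  filter_upwards [hM.supIntegral_const_mul hα hf c] with ω hω
  apply propext
  change _ ≤ (1 : ℝ≥0∞) ↔ supIntegral M (fun s => c * f s) ω ≤ 1
  rw [hω]

/-- For every `c > 0`, the probability of the value `∞` is at most that of exceeding `1 / c`, hence
at most `c ^ α ∫ f ^ α`. Then `c` tends to `0`. -/
theorem supIntegral_lt_top (hM : IsRandomSupMeasure α P μ M) (hα : 0 < α)
    [IsProbabilityMeasure P] {f : S → ℝ≥0} (hf : MemLPlus α μ f) :
    ∀ᵐ ω ∂P, supIntegral M (fun s => (f s : ℝ≥0∞)) ω < ∞ := by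
  have hm := hf.1.coe_nnreal_ennreal
  refine nonpos_iff_eq_zero.1 (ge_of_tendsto' (tendsto_rpow_mul_zero hα _ hf.2.ne) fun n => ?_)
  set c : ℝ≥0 := ((n : ℝ≥0) + 1)⁻¹
  have hc : c ≠ 0 := by positivity
  have hms : MeasurableSet {ω | c * supIntegral M (fun s => (f s : ℝ≥0∞)) ω ≤ 1} :=
    measurableSet_le ((hM.measurable_supIntegral hm).const_mul _) measurable_const
  calc _ ≤ P {ω | c * supIntegral M (fun s => (f s : ℝ≥0∞)) ω ≤ 1}ᶜ := by
        refine measure_mono fun ω hω => ?_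
        have h : supIntegral M (fun s => (f s : ℝ≥0∞)) ω = ∞ := not_lt_top_iff.1 hω
        simp [h, hc]
    _ = 1 - expNeg ((c : ℝ≥0∞) ^ α * ∫⁻ s, (f s : ℝ≥0∞) ^ α ∂μ) := by
        rw [prob_compl_eq_one_sub hms, hM.measure_mul_supIntegral_le_one hα hm]
    _ ≤ _ := tsub_le_iff_left.2 (one_le_expNeg_add _)

theorem _root_.lintegral_sup_rpow_le {f g : S → ℝ≥0} (hα : 0 < α) (hf : Measurable f) :
    ∫⁻ s, ((f s : ℝ≥0∞) ⊔ g s) ^ α ∂μ ≤ ∫⁻ s, (f s : ℝ≥0∞) ^ α ∂μ + rhoDist α μ f g := by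
  rw [rhoDist, ← lintegral_add_left (hf.coe_nnreal_ennreal.pow_const α)]
  refine lintegral_mono fun s => ?_
  rcases le_total (g s) (f s) with h | h
  · rw [sup_eq_left.2 (by exact_mod_cast h)]
    exact le_self_add
  · rw [sup_eq_right.2 (by exact_mod_cast h), ← ENNReal.coe_rpow_of_nonneg _ hα.le,
      ← ENNReal.coe_rpow_of_nonneg _ hα.le, ← ENNReal.ofReal_coe_nnreal, ← ENNReal.ofReal_coe_nnreal,
      ← ENNReal.ofReal_add (NNReal.coe_nonneg _) (abs_nonneg _)]
    refine ENNReal.ofReal_le_ofReal ?_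
    rw [NNReal.coe_rpow, NNReal.coe_rpow]
    linarith [neg_abs_le ((f s : ℝ) ^ α - (g s : ℝ) ^ α)]

theorem _root_.rhoDist_comm (f g : S → ℝ≥0) : rhoDist α μ f g = rhoDist α μ g f := by
  simp only [rhoDist, abs_sub_comm]

/-- The probability that a level separates two extremal integrals is controlled by the distance of
the integrands. -/
theorem measure_supIntegral_crossing_le (hM : IsRandomSupMeasure α P μ M) (hα : 0 < α)
    [IsProbabilityMeasure P] {f g : S → ℝ≥0} (hf : Measurable f) (hg : Measurable g) (c : ℝ≥0) :
    P {ω | c * supIntegral M (fun s => (f s : ℝ≥0∞)) ω ≤ 1 ∧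
      1 < c * supIntegral M (fun s => (g s : ℝ≥0∞)) ω} ≤ (c : ℝ≥0∞) ^ α * rhoDist α μ f g := by
  have hf' := hf.coe_nnreal_ennreal
  have hg' := hg.coe_nnreal_ennreal
  -- Almost surely `B ⊆ A`, and the crossing event lies in `A \ B`, since the integral of `f ⊔ g` is
  -- the maximum of the two integrals. So its probability is at most a difference of two
  -- exponentials whose exponents differ by at most `c ^ α` times the distance.
  set A := {ω | c * supIntegral M (fun s => (f s : ℝ≥0∞)) ω ≤ 1} with hA
  set B := {ω | c * supIntegral M (fun s => (f s : ℝ≥0∞) ⊔ g s) ω ≤ 1} with hB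
  have hBm : MeasurableSet B :=
    measurableSet_le ((hM.measurable_supIntegral (hf'.sup hg')).const_mul _) measurable_const
  have h1 : P A ≤ P B + (c : ℝ≥0∞) ^ α * rhoDist α μ f g := by
    rw [hA, hB, hM.measure_mul_supIntegral_le_one hα hf',
      hM.measure_mul_supIntegral_le_one hα (f := fun s => (f s : ℝ≥0∞) ⊔ g s) (hf'.sup hg')]
    refine (expNeg_le_expNeg_add_add _ ((c : ℝ≥0∞) ^ α * rhoDist α μ f g)).trans ?_
    gcongr
    refine expNeg_strictAnti.antitone ?_
    rw [← mul_add]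
    gcongr
    exact lintegral_sup_rpow_le hα hf
  have h2 : P {ω | c * supIntegral M (fun s => (f s : ℝ≥0∞)) ω ≤ 1 ∧
      1 < c * supIntegral M (fun s => (g s : ℝ≥0∞)) ω} ≤ P (A \ B) := by
    refine measure_mono_ae ?_
    filter_upwards [hM.supIntegral_sup hα hf' hg'] with ω hω h
    refine ⟨h.1, fun hωB => h.2.not_ge (le_trans ?_ hωB)⟩
    rw [hω]
    exact mul_le_mul_right le_sup_right _
  have h3 : P B + P (A \ B) = P A := by
    have hBA : P (A ∩ B) = P B := by
      refine measure_congr ?_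
      filter_upwards [hM.supIntegral_sup hα hf' hg'] with ω hω
      refine propext ⟨fun h => h.2, fun h => ⟨le_trans ?_ h, h⟩⟩
      rw [hω]
      exact mul_le_mul_right le_sup_left _
    rw [← measure_inter_add_sdiff A hBm, hBA]
  rw [← h3] at h1
  exact h2.trans ((ENNReal.add_le_add_iff_left (measure_ne_top P B)).1 h1)

/-- Every version of the extremal integral agrees almost surely with the canonical one. -/
theorem isExtremalIntegral_ae_eq (hM : IsRandomSupMeasure α P μ M) (hα : 0 < α)
    [IsProbabilityMeasure P] {f : S → ℝ≥0} (hf : MemLPlus α μ f) {ξ : Ω → ℝ}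
    (hξ : IsExtremalIntegral α P μ M f ξ) :
    ξ =ᵐ[P] fun ω => (supIntegral M (fun s => (f s : ℝ≥0∞)) ω).toReal := by
  obtain ⟨-, g, hg, hgf, hgξ⟩ := hξ
  have hlim : ∀ c : ℝ≥0, Tendsto (fun n => (c : ℝ≥0∞) ^ α * rhoDist α μ (g n) f) atTop (nhds 0) := by
    intro c
    have := ENNReal.Tendsto.const_mul (a := (c : ℝ≥0∞) ^ α) hgf
      (Or.inr (ENNReal.rpow_ne_top_of_nonneg hα.le ENNReal.coe_ne_top))
    rwa [mul_zero] at this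
  have key : ∀ (x : ℝ), 0 < x → ∀ z : ℝ≥0∞, z ≠ ∞ →
      (((Real.toNNReal x : ℝ≥0) : ℝ≥0∞)⁻¹ * z ≤ 1 ↔ z.toReal ≤ x) := by
    intro x hx z hz
    have hx' : ((Real.toNNReal x : ℝ≥0) : ℝ≥0∞) ≠ 0 := by simpa using hx
    lift z to ℝ≥0 using hz
    rw [ENNReal.coe_toReal, ← ENNReal.div_eq_inv_mul, ENNReal.div_le_iff hx' ENNReal.coe_ne_top,
      one_mul, ENNReal.coe_le_coe, ← NNReal.coe_le_coe, Real.coe_toNNReal _ hx.le]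
  have hx0 : ∀ x : ℝ, 0 < x → (((Real.toNNReal x)⁻¹ : ℝ≥0) : ℝ≥0∞) =
      ((Real.toNNReal x : ℝ≥0) : ℝ≥0∞)⁻¹ := fun x hx =>
    ENNReal.coe_inv (by simpa using hx)
  refine ae_eq_of_tendstoInMeasure_of_crossing hgξ (fun _ => ENNReal.toReal_nonneg) ?_ ?_
  · intro x hx
    rcases lt_or_gt_of_ne hx with hx | hx
    · have : ∀ n, {ω | (simpleExtremalIntegral M (g n) ω).toReal ≤ x ∧
          x < (supIntegral M (fun s => (f s : ℝ≥0∞)) ω).toReal} = ∅ := fun n =>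
        eq_empty_iff_forall_notMem.2 fun ω hω =>
          absurd hω.1 (not_le.2 (hx.trans_le ENNReal.toReal_nonneg))
      simp [this]
    · refine tendsto_of_tendsto_of_tendsto_of_le_of_le tendsto_const_nhds
        (hlim (Real.toNNReal x)⁻¹) (fun _ => zero_le) fun n => ?_
      refine le_trans (measure_mono_ae ?_)
        (hM.measure_supIntegral_crossing_le hα (g n).measurable hf.1 _)
      filter_upwards [hM.supIntegral_lt_top hα hf, hM.supIntegral_lt_top hα (hg n),
        hM.supIntegral_simpleFunc hα (g n)] with ω h1 h2 h3 hω
      obtain ⟨k1, k2⟩ := hω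
      rw [← h3] at k1
      refine ⟨?_, not_le.1 fun h => k2.not_ge ?_⟩
      · rw [hx0 x hx]
        exact (key x hx _ h2.ne).2 k1
      · rw [hx0 x hx] at h
        exact (key x hx _ h1.ne).1 h
  · intro x hx
    refine tendsto_of_tendsto_of_tendsto_of_le_of_le tendsto_const_nhds
      (hlim (Real.toNNReal x)⁻¹) (fun _ => zero_le) fun n => ?_
    rw [rhoDist_comm]
    refine le_trans (measure_mono_ae ?_)
      (hM.measure_supIntegral_crossing_le hα hf.1 (g n).measurable _)
    filter_upwards [hM.supIntegral_lt_top hα hf, hM.supIntegral_lt_top hα (hg n),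
      hM.supIntegral_simpleFunc hα (g n)] with ω h1 h2 h3 hω
    obtain ⟨k1, k2⟩ := hω
    rw [← h3] at k2
    refine ⟨?_, not_le.1 fun h => k2.not_ge ?_⟩
    · rw [hx0 x hx]
      exact (key x hx _ h1.ne).2 k1
    · rw [hx0 x hx] at h
      exact (key x hx _ h2.ne).1 h

theorem _root_.tendsto_rhoDist_nnrealApprox (hα : 0 < α) {f : S → ℝ≥0} (hf : MemLPlus α μ f) :
    Tendsto (fun n => rhoDist α μ (nnrealApprox (fun s => (f s : ℝ≥0∞)) n) f) atTop (nhds 0) := by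
  have hle : ∀ n s, nnrealApprox (fun s => (f s : ℝ≥0∞)) n s ≤ f s := fun n s => by
    rw [← ENNReal.coe_le_coe, ← iSup_coe_nnrealApprox hf.1.coe_nnreal_ennreal s]
    exact le_iSup (fun n => (nnrealApprox (fun s => (f s : ℝ≥0∞)) n s : ℝ≥0∞)) n
  have hlim : ∀ s, Tendsto (fun n => nnrealApprox (fun s => (f s : ℝ≥0∞)) n s) atTop
      (nhds (f s)) := fun s => by
    rw [← ENNReal.tendsto_coe, ← iSup_coe_nnrealApprox hf.1.coe_nnreal_ennreal s]
    exact tendsto_atTop_iSup fun i j hij => monotone_coe_nnrealApprox _ hij s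
  have h := tendsto_lintegral_of_dominated_convergence (μ := μ)
    (F := fun n s => ENNReal.ofReal |(nnrealApprox (fun s => (f s : ℝ≥0∞)) n s : ℝ) ^ α -
      (f s : ℝ) ^ α|) (f := fun _ => 0) (fun s => (f s : ℝ≥0∞) ^ α) ?_ ?_ hf.2.ne ?_
  · simpa [rhoDist] using h
  · intro n
    have h1 := (nnrealApprox (fun s => (f s : ℝ≥0∞)) n).measurable.coe_nnreal_real.pow_const α
    have h2 := hf.1.coe_nnreal_real.pow_const α
    exact (continuous_abs.measurable.comp (h1.sub h2)).ennreal_ofReal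
  · refine fun n => ae_of_all _ fun s => ?_
    beta_reduce
    rw [← ENNReal.coe_rpow_of_nonneg _ hα.le, ← ENNReal.ofReal_coe_nnreal]
    refine ENNReal.ofReal_le_ofReal ?_
    rw [NNReal.coe_rpow]
    have h1 : (nnrealApprox (fun s => (f s : ℝ≥0∞)) n s : ℝ) ^ α ≤ (f s : ℝ) ^ α :=
      Real.rpow_le_rpow (NNReal.coe_nonneg _) (by exact_mod_cast hle n s) hα.le
    have h0 : 0 ≤ (nnrealApprox (fun s => (f s : ℝ≥0∞)) n s : ℝ) ^ α :=
      Real.rpow_nonneg (NNReal.coe_nonneg _) _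
    rw [abs_sub_comm, abs_of_nonneg (by linarith)]
    linarith
  · refine ae_of_all _ fun s => ?_
    have h1 : Tendsto (fun n => (nnrealApprox (fun s => (f s : ℝ≥0∞)) n s : ℝ) ^ α) atTop
        (nhds ((f s : ℝ) ^ α)) :=
      ((NNReal.tendsto_coe.2 (hlim s))).rpow_const (Or.inr hα.le)
    have h2 := (h1.sub_const ((f s : ℝ) ^ α)).abs
    rw [sub_self, abs_zero] at h2
    simpa using ENNReal.tendsto_ofReal h2

theorem isExtremalIntegral_toReal_supIntegral (hM : IsRandomSupMeasure α P μ M) (hα : 0 < α)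
    [IsProbabilityMeasure P] {f : S → ℝ≥0} (hf : MemLPlus α μ f) :
    IsExtremalIntegral α P μ M f
      fun ω => (supIntegral M (fun s => (f s : ℝ≥0∞)) ω).toReal := by
  have hf' := hf.1.coe_nnreal_ennreal
  refine ⟨(hM.measurable_supIntegral hf').ennreal_toReal,
    nnrealApprox (fun s => (f s : ℝ≥0∞)), fun n => ⟨SimpleFunc.measurable _, ?_⟩,
    tendsto_rhoDist_nnrealApprox hα hf, ?_⟩
  · refine lt_of_le_of_lt (lintegral_mono fun s => ?_) hf.2
    refine ENNReal.rpow_le_rpow ?_ hα.le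
    rw [← iSup_coe_nnrealApprox hf' s]
    exact le_iSup (fun n => (nnrealApprox (fun s => (f s : ℝ≥0∞)) n s : ℝ≥0∞)) n
  · refine tendstoInMeasure_of_tendsto_ae
      (fun n => (hM.measurable_simpleExtremalIntegral _).ennreal_toReal.aestronglyMeasurable) ?_
    filter_upwards [hM.supIntegral_lt_top hα hf, hM.supIntegral_nnrealApprox hα hf'] with ω h1 h2
    refine (ENNReal.tendsto_toReal h1.ne).comp ?_
    rw [← h2.2]
    exact tendsto_atTop_iSup h2.1

theorem extremalIntegral_ae_eq (hM : IsRandomSupMeasure α P μ M) (hα : 0 < α)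
    [IsProbabilityMeasure P] {f : S → ℝ≥0} (hf : MemLPlus α μ f) :
    extremalIntegral α P μ M f =ᵐ[P]
      fun ω => (supIntegral M (fun s => (f s : ℝ≥0∞)) ω).toReal := by
  have h : ∃ ξ, IsExtremalIntegral α P μ M f ξ :=
    ⟨_, hM.isExtremalIntegral_toReal_supIntegral hα hf⟩
  rw [extremalIntegral, dif_pos h]
  exact hM.isExtremalIntegral_ae_eq hα hf h.choose_spec

theorem _root_.measurable_extremalIntegral (f : S → ℝ≥0) :
    Measurable (extremalIntegral α P μ M f) := by
  unfold extremalIntegral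
  split_ifs with h
  · exact h.choose_spec.1
  · exact measurable_const

end IsRandomSupMeasure

/-! ### Laws of nonnegative processes -/

/-- The boxes `{y | ∀ (t, c) ∈ s, c * y t ≤ 1}`; they generate the product `σ`-field. -/
def box {T : Type*} (s : Finset (T × ℝ≥0)) : Set (T → ℝ≥0) := {y | ∀ p ∈ s, p.2 * y p.1 ≤ 1}

section Box

variable {T : Type*}

theorem measurableSet_box (s : Finset (T × ℝ≥0)) : MeasurableSet (box s) := by
  have : box s = ⋂ p ∈ s, {y : T → ℝ≥0 | p.2 * y p.1 ≤ 1} := by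
    ext y; simp [box]
  rw [this]
  refine Finset.measurableSet_biInter _ fun p _ => ?_
  have h : Measurable fun y : T → ℝ≥0 => y p.1 := measurable_pi_apply p.1
  exact measurableSet_le (h.const_mul p.2) measurable_const

theorem isPiSystem_box : IsPiSystem (range (box (T := T))) := by
  classical
  rintro _ ⟨s, rfl⟩ _ ⟨u, rfl⟩ -
  refine ⟨s ∪ u, ?_⟩
  ext y
  simp only [box, mem_ofPred_eq, mem_inter_iff, Finset.mem_union]
  exact ⟨fun h => ⟨fun p hp => h p (Or.inl hp), fun p hp => h p (Or.inr hp)⟩,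
    fun h p hp => hp.elim (h.1 p) (h.2 p)⟩

theorem generateFrom_box :
    (MeasurableSpace.pi : MeasurableSpace (T → ℝ≥0)) =
      MeasurableSpace.generateFrom (range box) := by
  apply le_antisymm
  · refine iSup_le fun t => ?_
    rw [BorelSpace.measurable_eq (α := ℝ≥0), borel_eq_generateFrom_Iic,
      MeasurableSpace.comap_generateFrom]
    refine MeasurableSpace.generateFrom_le ?_
    rintro _ ⟨_, ⟨a, rfl⟩, rfl⟩
    have hpos : ∀ a : ℝ≥0, a ≠ 0 →
        MeasurableSet[MeasurableSpace.generateFrom (range box)] ({y : T → ℝ≥0 | y t ≤ a}) := by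
      intro a ha
      refine MeasurableSpace.measurableSet_generateFrom ⟨{(t, a⁻¹)}, ?_⟩
      ext y
      simp only [box, Finset.mem_singleton, forall_eq, mem_ofPred_eq]
      rw [inv_mul_le_iff₀ (pos_iff_ne_zero.2 ha), mul_one]
    -- A box bounds a coordinate by `a` through the coefficient `a⁻¹`, so the bound `0` must be
    -- obtained as a countable intersection.
    rcases eq_or_ne a 0 with rfl | ha
    · have : (fun y : T → ℝ≥0 => y t) ⁻¹' Iic 0 =
          ⋂ n : ℕ, {y : T → ℝ≥0 | y t ≤ 1 / ((n : ℝ≥0) + 1)} := by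
        ext y
        simp only [mem_preimage, mem_Iic, mem_iInter, mem_ofPred_eq]
        exact ⟨fun h n => h.trans zero_le, fun h =>
          ge_of_tendsto' (tendsto_one_div_add_atTop_nhds_zero_nat (𝕜 := ℝ≥0)) h⟩
      rw [this]
      exact MeasurableSet.iInter fun n => hpos _ (by positivity)
    · exact hpos a ha
  · refine MeasurableSpace.generateFrom_le ?_
    rintro _ ⟨s, rfl⟩
    exact measurableSet_box s

theorem Measure.ext_of_box {m m' : Measure (T → ℝ≥0)} [IsFiniteMeasure m]
    (h : ∀ s, m (box s) = m' (box s)) : m = m' := by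
  refine ext_of_generate_finite _ generateFrom_box isPiSystem_box ?_ ?_
  · rintro _ ⟨s, rfl⟩
    exact h s
  · simpa [box] using h ∅

end Box

/-- The path of the nonnegative part of a process. -/
noncomputable def nnPath {T Ω : Type*} (X : T → Ω → ℝ) : Ω → T → ℝ≥0 := fun ω t => (X t ω).toNNReal

theorem nnPath_preimage_box {T Ω : Type*} (X : T → Ω → ℝ) (s : Finset (T × ℝ≥0)) :
    nnPath X ⁻¹' box s = {ω | ∀ p ∈ s, (p.2 : ℝ) * X p.1 ω ≤ 1} := by
  ext ω
  simp only [box, nnPath, mem_preimage, mem_ofPred_eq]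
  refine forall₂_congr fun p _ => ?_
  rw [← NNReal.coe_le_coe, NNReal.coe_mul, NNReal.coe_one]
  rcases le_total 0 (X p.1 ω) with h | h
  · rw [Real.coe_toNNReal _ h]
  · rw [Real.toNNReal_of_nonpos h]
    simp only [NNReal.coe_zero, mul_zero, zero_le_one, true_iff]
    exact (mul_nonpos_of_nonneg_of_nonpos p.2.coe_nonneg h).trans zero_le_one

/-- The law of the nonnegative process `X` is given by `P (∀ (t, c) ∈ s, c * X t ≤ 1) =
exp (-L s)`. -/
structure HasExponent {T Ω : Type*} [MeasurableSpace Ω] (P : Measure Ω) (X : T → Ω → ℝ)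
    (L : Finset (T × ℝ≥0) → ℝ≥0∞) : Prop where
  measurable : ∀ t, Measurable (X t)
  nonneg : ∀ t, ∀ᵐ ω ∂P, 0 ≤ X t ω
  law : ∀ s : Finset (T × ℝ≥0), P {ω | ∀ p ∈ s, (p.2 : ℝ) * X p.1 ω ≤ 1} = expNeg (L s)

section Law

variable {T Ω Ω' : Type*} [MeasurableSpace Ω] [MeasurableSpace Ω'] {P : Measure Ω}
  {P' : Measure Ω'} {X : T → Ω → ℝ} {Y : T → Ω' → ℝ}

theorem measurable_path (hX : ∀ t, Measurable (X t)) : Measurable (path X) :=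
  measurable_pi_lambda _ hX

theorem measurable_nnPath (hX : ∀ t, Measurable (X t)) : Measurable (nnPath X) :=
  measurable_pi_lambda _ fun t => (hX t).real_toNNReal

theorem path_ae_eq (h0 : ∀ t, ∀ᵐ ω ∂P, 0 ≤ X t ω) (t : T) :
    (fun ω => ((nnPath X ω t : ℝ≥0) : ℝ)) =ᵐ[P] X t := by
  filter_upwards [h0 t] with ω hω
  exact Real.coe_toNNReal _ hω

theorem measurable_coe_path : Measurable fun (y : T → ℝ≥0) (t : T) => (y t : ℝ) :=
  measurable_pi_lambda _ fun t => (measurable_pi_apply t).coe_nnreal_real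

/-- For uncountable `T` there may be no common null set outside which the whole path is nonnegative.
Almost sure equality at each `t` still gives equal laws on the product space. -/
theorem map_path_eq [IsFiniteMeasure P] (hX : ∀ t, Measurable (X t))
    (h0 : ∀ t, ∀ᵐ ω ∂P, 0 ≤ X t ω) :
    P.map (path X) = (P.map (nnPath X)).map fun y t => (y t : ℝ) := by
  rw [Measure.map_map measurable_coe_path (measurable_nnPath hX)]
  exact (map_eq_of_forall_ae_eq
    (measurable_coe_path.comp (measurable_nnPath hX)).aemeasurable
    (measurable_path hX).aemeasurable (path_ae_eq h0)).symm

theorem HasExponent.eqInDist [IsFiniteMeasure P] [IsFiniteMeasure P']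
    {L : Finset (T × ℝ≥0) → ℝ≥0∞} (hX : HasExponent P X L) (hY : HasExponent P' Y L) :
    EqInDist P P' X Y := by
  refine ⟨(measurable_path hX.measurable).aemeasurable, (measurable_path hY.measurable).aemeasurable,
    ?_⟩
  rw [map_path_eq hX.measurable hX.nonneg, map_path_eq hY.measurable hY.nonneg]
  congr 1
  refine Measure.ext_of_box fun s => ?_
  rw [Measure.map_apply (measurable_nnPath hX.measurable) (measurableSet_box s),
    Measure.map_apply (measurable_nnPath hY.measurable) (measurableSet_box s),
    nnPath_preimage_box, nnPath_preimage_box, hX.law, hY.law]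

theorem measurableSet_path_box (s : Finset (T × ℝ≥0)) :
    MeasurableSet {x : T → ℝ | ∀ p ∈ s, (p.2 : ℝ) * x p.1 ≤ 1} := by
  have : {x : T → ℝ | ∀ p ∈ s, (p.2 : ℝ) * x p.1 ≤ 1} =
      ⋂ p ∈ s, {x : T → ℝ | (p.2 : ℝ) * x p.1 ≤ 1} := by
    ext y; simp
  rw [this]
  exact Finset.measurableSet_biInter _ fun p _ =>
    measurableSet_le ((measurable_pi_apply p.1).const_mul _) measurable_const

theorem HasExponent.exponent_eq {L L' : Finset (T × ℝ≥0) → ℝ≥0∞} (hX : HasExponent P X L)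
    (hY : HasExponent P' Y L') (h : EqInDist P P' X Y) : L = L' := by
  ext s
  refine expNeg_strictAnti.injective ?_
  rw [← hX.law, ← hY.law]
  exact h.measure_mem_eq (measurableSet_path_box s)

theorem HasExponent.congr {L : Finset (T × ℝ≥0) → ℝ≥0∞} {X' : T → Ω → ℝ}
    (hX : HasExponent P X L) (hX' : ∀ t, Measurable (X' t)) (h : ∀ t, X' t =ᵐ[P] X t) :
    HasExponent P X' L where
  measurable := hX'
  nonneg t := by
    filter_upwards [h t, hX.nonneg t] with ω h1 h2
    rwa [h1]
  law s := by
    rw [← hX.law]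
    refine measure_congr ?_
    have h' : ∀ᵐ ω ∂P, ∀ p ∈ s, X' p.1 ω = X p.1 ω :=
      (ae_ball_iff s.countable_toSet).2 fun p _ => h p.1
    filter_upwards [h'] with ω hω
    refine propext (forall₂_congr fun p hp => ?_)
    rw [hω p hp]

theorem indepFun_path_of_box {U : Type*} {Y : U → Ω → ℝ} [IsProbabilityMeasure P]
    (hX : ∀ t, Measurable (X t)) (hX0 : ∀ t, ∀ᵐ ω ∂P, 0 ≤ X t ω)
    (hY : ∀ t, Measurable (Y t)) (hY0 : ∀ t, ∀ᵐ ω ∂P, 0 ≤ Y t ω)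
    (h : ∀ s u, P (nnPath X ⁻¹' box s ∩ nnPath Y ⁻¹' box u) =
      P (nnPath X ⁻¹' box s) * P (nnPath Y ⁻¹' box u)) :
    IndepFun (path X) (path Y) P := by
  have h1 : IndepFun (nnPath X) (nnPath Y) P := by
    rw [IndepFun_iff_Indep]
    refine IndepSets.indep (measurable_nnPath hX).comap_le (measurable_nnPath hY).comap_le
      (isPiSystem_box.comap (nnPath X)) (isPiSystem_box.comap (nnPath Y)) ?_ ?_ ?_
    · rw [generateFrom_box, MeasurableSpace.comap_generateFrom]
      rfl
    · rw [generateFrom_box, MeasurableSpace.comap_generateFrom]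
      rfl
    · rw [IndepSets_iff]
      rintro _ _ ⟨_, ⟨s, rfl⟩, rfl⟩ ⟨_, ⟨u, rfl⟩, rfl⟩
      exact h s u
  exact (h1.comp measurable_coe_path measurable_coe_path).process_congr
    (path_ae_eq hX0) (path_ae_eq hY0)

end Law

/-! ### Processes of extremal integrals -/

/-- The exponent of the process of the extremal integrals of the functions `f t`. -/
noncomputable def exponent {T S : Type*} [MeasurableSpace S] (α : ℝ) (μ : Measure S)
    (f : T → S → ℝ≥0) (s : Finset (T × ℝ≥0)) : ℝ≥0∞ :=
  ∫⁻ x, (s.sup fun p => (p.2 : ℝ≥0∞) * f p.1 x) ^ α ∂μ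

theorem measurable_finset_sup_mul {T S : Type*} [MeasurableSpace S] {f : T → S → ℝ≥0}
    (hf : ∀ t, Measurable (f t)) (s : Finset (T × ℝ≥0)) :
    Measurable fun x => s.sup fun p => (p.2 : ℝ≥0∞) * f p.1 x := by
  simp only [Finset.sup_eq_iSup]
  exact Measurable.biSup _ s.countable_toSet fun p _ => (hf p.1).coe_nnreal_ennreal.const_mul _

namespace IsRandomSupMeasure

variable {T S Ω : Type*} [MeasurableSpace S] [MeasurableSpace Ω] {α : ℝ} {P : Measure Ω}
  {μ : Measure S} {M : Set S → Ω → ℝ≥0∞}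

theorem extremalIntegral_box_ae_eq (hM : IsRandomSupMeasure α P μ M) (hα : 0 < α)
    [IsProbabilityMeasure P] {f : T → S → ℝ≥0} (hf : ∀ t, MemLPlus α μ (f t))
    (s : Finset (T × ℝ≥0)) :
    {ω | ∀ p ∈ s, (p.2 : ℝ) * extremalIntegral α P μ M (f p.1) ω ≤ 1} =ᵐ[P]
      {ω | supIntegral M (fun x => s.sup fun p => (p.2 : ℝ≥0∞) * f p.1 x) ω ≤ 1} := by
  have h1 : ∀ᵐ ω ∂P, ∀ p ∈ s, extremalIntegral α P μ M (f p.1) ω =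
      (supIntegral M (fun x => (f p.1 x : ℝ≥0∞)) ω).toReal ∧
      supIntegral M (fun x => (f p.1 x : ℝ≥0∞)) ω < ∞ ∧
      supIntegral M (fun x => (p.2 : ℝ≥0∞) * f p.1 x) ω =
        p.2 * supIntegral M (fun x => (f p.1 x : ℝ≥0∞)) ω := by
    refine (ae_ball_iff s.countable_toSet).2 fun p _ => ?_
    filter_upwards [hM.extremalIntegral_ae_eq hα (hf p.1), hM.supIntegral_lt_top hα (hf p.1),
      hM.supIntegral_const_mul hα (hf p.1).1.coe_nnreal_ennreal p.2] with ω k1 k2 k3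
    exact ⟨k1, k2, k3⟩
  filter_upwards [h1, hM.supIntegral_finset_sup hα s
    (f := fun (p : T × ℝ≥0) x => (p.2 : ℝ≥0∞) * f p.1 x)
    (fun p => (hf p.1).1.coe_nnreal_ennreal.const_mul _)] with ω h1 h2
  apply propext
  change (∀ p ∈ s, _) ↔ supIntegral M (fun x => s.sup fun p => (p.2 : ℝ≥0∞) * f p.1 x) ω ≤ 1
  rw [h2, Finset.sup_le_iff]
  refine forall₂_congr fun p hp => ?_
  obtain ⟨k1, k2, k3⟩ := h1 p hp
  rw [k1, k3]
  lift supIntegral M (fun x => (f p.1 x : ℝ≥0∞)) ω to ℝ≥0 using k2.ne with z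
  rw [ENNReal.coe_toReal]
  norm_cast

/-- By max-linearity, the maximum of the `c X_t` is the extremal integral of the maximum of the `c
f_t`, so a joint law reduces to one distribution function. -/
theorem hasExponent (hM : IsRandomSupMeasure α P μ M) (hα : 0 < α)
    [IsProbabilityMeasure P] {f : T → S → ℝ≥0} (hf : ∀ t, MemLPlus α μ (f t)) :
    HasExponent P (fun t => extremalIntegral α P μ M (f t)) (exponent α μ f) where
  measurable t := measurable_extremalIntegral _
  nonneg t := by
    filter_upwards [hM.extremalIntegral_ae_eq hα (hf t)] with ω hω
    rw [hω]
    exact ENNReal.toReal_nonneg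
  law s := by
    rw [measure_congr (hM.extremalIntegral_box_ae_eq hα hf s),
      hM.measure_supIntegral_le_one hα (measurable_finset_sup_mul (fun t => (hf t).1) s), exponent]

/-- Extremal integrals of functions with disjoint supports are independent. -/
theorem indepFun_extremalIntegral (hM : IsRandomSupMeasure α P μ M) (hα : 0 < α)
    [IsProbabilityMeasure P] {U : Type*} {f : T → S → ℝ≥0} {g : U → S → ℝ≥0}
    (hf : ∀ t, MemLPlus α μ (f t)) (hg : ∀ t, MemLPlus α μ (g t))
    (hfg : ∀ t u x, f t x = 0 ∨ g u x = 0) :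
    IndepFun (path fun t => extremalIntegral α P μ M (f t))
      (path fun t => extremalIntegral α P μ M (g t)) P := by
  have hF := hM.hasExponent hα hf
  have hG := hM.hasExponent hα hg
  refine indepFun_path_of_box hF.measurable hF.nonneg hG.measurable hG.nonneg fun s u => ?_
  rw [nnPath_preimage_box, nnPath_preimage_box, hF.law, hG.law, ← expNeg_add, exponent, exponent,
    ← lintegral_add_left ((measurable_finset_sup_mul (fun t => (hf t).1) s).pow_const α)]
  -- At each point one of the two suprema vanishes, so the sum of the powers is the power of the
  -- maximum.
  have h1 : ∀ x, (s.sup fun p => (p.2 : ℝ≥0∞) * f p.1 x) ^ α +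
      (u.sup fun p => (p.2 : ℝ≥0∞) * g p.1 x) ^ α =
      ((s.sup fun p => (p.2 : ℝ≥0∞) * f p.1 x) ⊔ u.sup fun p => (p.2 : ℝ≥0∞) * g p.1 x) ^ α := by
    intro x
    have h : (s.sup fun p => (p.2 : ℝ≥0∞) * f p.1 x) = 0 ∨
        (u.sup fun p => (p.2 : ℝ≥0∞) * g p.1 x) = 0 := by
      by_cases hx : ∀ t, f t x = 0
      · left
        simp [hx]
      · right
        obtain ⟨t, ht⟩ := not_forall.1 hx
        have : ∀ v, g v x = 0 := fun v => (hfg t v x).resolve_left ht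
        simp [this]
    rcases h with h | h <;> simp [h, hα]
  simp_rw [h1]
  rw [← hM.measure_supIntegral_le_one hα (f := fun x => (s.sup fun p => (p.2 : ℝ≥0∞) * f p.1 x) ⊔
    u.sup fun p => (p.2 : ℝ≥0∞) * g p.1 x) ((measurable_finset_sup_mul (fun t => (hf t).1) s).sup
    (measurable_finset_sup_mul (fun t => (hg t).1) u))]
  refine measure_congr ?_
  refine ((hM.extremalIntegral_box_ae_eq hα hf s).inter
    (hM.extremalIntegral_box_ae_eq hα hg u)).trans ?_
  filter_upwards [hM.supIntegral_sup hα (measurable_finset_sup_mul (fun t => (hf t).1) s)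
    (measurable_finset_sup_mul (fun t => (hg t).1) u)] with ω hω
  apply propext
  change (_ ≤ (1 : ℝ≥0∞) ∧ _ ≤ (1 : ℝ≥0∞)) ↔ supIntegral M (fun x =>
    (s.sup fun p => (p.2 : ℝ≥0∞) * f p.1 x) ⊔ u.sup fun p => (p.2 : ℝ≥0∞) * g p.1 x) ω ≤ 1
  rw [hω, sup_le_iff]

end IsRandomSupMeasure

/-! ### Fréchet marginals and max-stability -/

section FrechetProcess

variable {T S Ω : Type*} [MeasurableSpace S] [MeasurableSpace Ω] {α : ℝ} {P : Measure Ω}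
  {μ : Measure S}

theorem exponent_singleton (hα : 0 < α) {f : T → S → ℝ≥0} {t : T} (hf : Measurable (f t))
    (c : ℝ≥0) :
    exponent α μ f {(t, c)} = (c : ℝ≥0∞) ^ α * ∫⁻ x, (f t x : ℝ≥0∞) ^ α ∂μ := by
  simp only [exponent, Finset.sup_singleton, ENNReal.mul_rpow_of_nonneg _ _ hα.le]
  exact lintegral_const_mul _ (hf.coe_nnreal_ennreal.pow_const α)

open Classical in
/-- Multiplication of all the coefficients of a finite family by `c`. -/
noncomputable def scaleCoeff (c : ℝ≥0) (s : Finset (T × ℝ≥0)) : Finset (T × ℝ≥0) :=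
  s.image fun p => (p.1, c * p.2)

theorem sup_scaleCoeff (c : ℝ≥0) (s : Finset (T × ℝ≥0)) (y : T → ℝ≥0) :
    ((scaleCoeff c s).sup fun p => (p.2 : ℝ≥0∞) * y p.1) =
      c * s.sup fun p => (p.2 : ℝ≥0∞) * y p.1 := by
  classical
  rw [scaleCoeff, Finset.sup_image]
  simp only [Finset.sup_eq_iSup, ENNReal.mul_iSup]
  simp [mul_assoc]

theorem exponent_scaleCoeff (hα : 0 < α) {f : T → S → ℝ≥0} (hf : ∀ t, Measurable (f t))
    (c : ℝ≥0) (s : Finset (T × ℝ≥0)) :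
    exponent α μ f (scaleCoeff c s) = (c : ℝ≥0∞) ^ α * exponent α μ f s := by
  have h : ∀ x, ((scaleCoeff c s).sup fun p => (p.2 : ℝ≥0∞) * f p.1 x) =
      c * s.sup fun p => (p.2 : ℝ≥0∞) * f p.1 x := fun x => sup_scaleCoeff c s fun t => f t x
  simp only [exponent, h, ENNReal.mul_rpow_of_nonneg _ _ hα.le]
  exact lintegral_const_mul _ ((measurable_finset_sup_mul hf s).pow_const α)

/-- A process with the exponent of a family of extremal integrals is a Fréchet process. -/
theorem HasExponent.isFrechetProcess (hα : 0 < α) [IsProbabilityMeasure P] {X : T → Ω → ℝ}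
    {f : T → S → ℝ≥0} (hf : ∀ t, MemLPlus α μ (f t)) (hX : HasExponent P X (exponent α μ f)) :
    IsFrechetProcess α P X := by
  refine ⟨hX.measurable, hX.nonneg, fun t => ?_, fun n => ?_⟩
  · refine ⟨(∫⁻ x, (f t x : ℝ≥0∞) ^ α ∂μ) ^ (1 / α),
      ENNReal.rpow_ne_top_of_nonneg (by positivity) (hf t).2.ne, (hX.measurable t).ennreal_ofReal,
      fun x hx => ?_⟩
    have h := hX.law {(t, (Real.toNNReal x)⁻¹)}
    rw [exponent_singleton hα (hf t).1] at h
    rw [← ENNReal.rpow_mul, one_div, inv_mul_cancel₀ hα.ne', ENNReal.rpow_one]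
    have hx' : (0 : ℝ≥0) < Real.toNNReal x := Real.toNNReal_pos.2 hx
    have hc : (((Real.toNNReal x)⁻¹ : ℝ≥0) : ℝ≥0∞) ^ α = ENNReal.ofReal (x ^ (-α)) := by
      rw [ENNReal.coe_inv hx'.ne', ENNReal.inv_rpow, ← ENNReal.rpow_neg,
        ← ENNReal.ofReal_rpow_of_pos hx]
      rfl
    rw [hc, mul_comm] at h
    refine Eq.trans (congrArg P ?_) h
    ext ω
    simp only [Finset.mem_singleton, forall_eq, mem_ofPred_eq]
    rw [ENNReal.ofReal_le_ofReal_iff hx.le, NNReal.coe_inv, Real.coe_toNNReal _ hx.le,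
      inv_mul_le_iff₀ hx, mul_one]
  · set Q := P.map (path X) with hQ
    have hQp : IsProbabilityMeasure Q :=
      Measure.isProbabilityMeasure_map (measurable_path hX.measurable).aemeasurable
    have hQ0 : ∀ t, ∀ᵐ x ∂Q, 0 ≤ x t := fun t =>
      (ae_map_iff (measurable_path hX.measurable).aemeasurable
        (measurableSet_le measurable_const (measurable_pi_apply t))).2 (hX.nonneg t)
    have hQbox : ∀ s, Q {x : T → ℝ | ∀ p ∈ s, (p.2 : ℝ) * x p.1 ≤ 1} =
        expNeg (exponent α μ f s) := fun s => by
      rw [hQ, Measure.map_apply (measurable_path hX.measurable) (measurableSet_path_box s)]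
      exact hX.law s
    -- Both sides of max-stability have exponent `(n + 1) L`: for the maximum because independent
    -- copies multiply probabilities, for the rescaled process because `L` is homogeneous of degree
    -- `α`.
    have h1 : HasExponent (Measure.pi fun _ : Fin (n + 1) => Q)
        (fun (t : T) (y : Fin (n + 1) → T → ℝ) => ⨆ i, y i t)
        (fun s => (n + 1 : ℕ) * exponent α μ f s) := by
      refine ⟨fun t => Measurable.iSup fun i => (measurable_pi_apply t).comp (measurable_pi_apply i),
        fun t => ?_, fun s => ?_⟩
      · have h0 : ∀ᵐ y ∂(Measure.pi fun _ : Fin (n + 1) => Q), 0 ≤ y 0 t :=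
          (measurePreserving_eval (fun _ : Fin (n + 1) => Q) 0).quasiMeasurePreserving.ae (hQ0 t)
        filter_upwards [h0] with y hy
        exact hy.trans (le_ciSup (f := fun i => y i t) (Set.finite_range _).bddAbove 0)
      · have hs : {y : Fin (n + 1) → T → ℝ | ∀ p ∈ s, (p.2 : ℝ) * ⨆ i, y i p.1 ≤ 1} =
            Set.univ.pi fun _ => {x : T → ℝ | ∀ p ∈ s, (p.2 : ℝ) * x p.1 ≤ 1} := by
          ext y
          simp only [mem_ofPred_eq, mem_univ_pi]
          rw [forall_comm]
          refine forall_congr' fun p => ?_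
          rw [forall_comm]
          refine forall_congr' fun _ => ?_
          rw [Real.mul_iSup_of_nonneg p.2.coe_nonneg]
          exact ciSup_le_iff (Set.finite_range _).bddAbove
        rw [hs, Measure.pi_pi]
        simp_rw [hQbox]
        rw [← expNeg_sum]
        simp
    have h2 : HasExponent Q (fun (t : T) (x : T → ℝ) => ((n + 1 : ℕ) : ℝ) ^ (1 / α) * x t)
        (fun s => (n + 1 : ℕ) * exponent α μ f s) := by
      refine ⟨fun t => (measurable_pi_apply t).const_mul _, fun t => ?_, fun s => ?_⟩
      · filter_upwards [hQ0 t] with x hx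
        positivity
      · have hs : {x : T → ℝ | ∀ p ∈ s, (p.2 : ℝ) * (((n + 1 : ℕ) : ℝ) ^ (1 / α) * x p.1) ≤ 1} =
            {x : T → ℝ | ∀ p ∈ scaleCoeff (((n + 1 : ℕ) : ℝ≥0) ^ (1 / α)) s,
              (p.2 : ℝ) * x p.1 ≤ 1} := by
          ext x
          simp only [scaleCoeff, Finset.mem_image, mem_ofPred_eq, forall_exists_index, and_imp,
            forall_apply_eq_imp_iff₂]
          refine forall₂_congr fun p _ => ?_
          rw [NNReal.coe_mul, NNReal.coe_rpow, NNReal.coe_natCast, ← mul_assoc, mul_comm (p.2 : ℝ)]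
        rw [hs, hQbox, exponent_scaleCoeff hα fun t => (hf t).1,
          ENNReal.coe_rpow_of_nonneg _ (by positivity), ← ENNReal.rpow_mul, one_div,
          inv_mul_cancel₀ hα.ne', ENNReal.rpow_one, ENNReal.coe_natCast]
    exact (h1.eqInDist h2).map_eq

end FrechetProcess

/-! ### The law of the ratios is determined by the exponent -/

section RatioLaw

variable {T S : Type*} [MeasurableSpace S] {α : ℝ} {μ : Measure S} {f : T → S → ℝ≥0}

/-- The ratios `f t / f t₀`. -/
noncomputable def ratioMap (f : T → S → ℝ≥0) (t₀ : T) (x : S) : T → ℝ≥0 := fun t => f t x / f t₀ x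

/-- The measure with density `f t₀ ^ α`. -/
noncomputable def powMeasure (α : ℝ) (μ : Measure S) (f : T → S → ℝ≥0) (t₀ : T) : Measure S :=
  μ.withDensity fun x => (f t₀ x : ℝ≥0∞) ^ α

theorem measurable_ratioMap (hf : ∀ t, Measurable (f t)) (t₀ : T) : Measurable (ratioMap f t₀) :=
  measurable_pi_lambda _ fun t => (hf t).div (hf t₀)

theorem isFiniteMeasure_powMeasure (hf : ∀ t, MemLPlus α μ (f t)) (t₀ : T) :
    IsFiniteMeasure (powMeasure α μ f t₀) :=
  isFiniteMeasure_withDensity (hf t₀).2.ne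

theorem exponent_lt_top (hα : 0 < α) (hf : ∀ t, MemLPlus α μ (f t)) (s : Finset (T × ℝ≥0)) :
    exponent α μ f s < ∞ := by
  have h1 : ∀ x, (s.sup fun p => (p.2 : ℝ≥0∞) * f p.1 x) ^ α ≤
      ∑ p ∈ s, (p.2 : ℝ≥0∞) ^ α * (f p.1 x : ℝ≥0∞) ^ α := by
    intro x
    rw [Finset.apply_sup_eq_sup_comp_of_linearOrder (fun z : ℝ≥0∞ => z ^ α)
      (ENNReal.monotone_rpow_of_nonneg hα.le) (by simp [hα])]
    refine Finset.sup_le fun p hp => ?_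
    simp only [Function.comp, ENNReal.mul_rpow_of_nonneg _ _ hα.le]
    exact Finset.single_le_sum (f := fun p : T × ℝ≥0 => (p.2 : ℝ≥0∞) ^ α * (f p.1 x : ℝ≥0∞) ^ α)
      (fun _ _ => zero_le) hp
  refine (lintegral_mono h1).trans_lt ?_
  rw [lintegral_finsetSum _ fun p _ => ((hf p.1).1.coe_nnreal_ennreal.pow_const α).const_mul _]
  refine ENNReal.sum_lt_top.2 fun p _ => ?_
  rw [lintegral_const_mul _ ((hf p.1).1.coe_nnreal_ennreal.pow_const α)]
  exact ENNReal.mul_lt_top (ENNReal.rpow_lt_top_of_nonneg hα.le ENNReal.coe_ne_top) (hf p.1).2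

open Classical in
-- Coefficients enter as `1 / α`-th powers so that `a` and `b` appear linearly inside the maximum,
-- ready for differencing in `a`.
theorem exponent_insert_scaleCoeff (hα : 0 < α) (t₀ : T) (a b : ℝ≥0) (s : Finset (T × ℝ≥0)) :
    exponent α μ f (insert (t₀, a ^ (1 / α)) (scaleCoeff (b ^ (1 / α)) s)) =
      ∫⁻ x, (a * (f t₀ x : ℝ≥0∞) ^ α) ⊔ (b * (s.sup fun p => (p.2 : ℝ≥0∞) * f p.1 x) ^ α) ∂μ := by
  refine lintegral_congr fun x => ?_
  rw [Finset.sup_insert, sup_scaleCoeff _ _ fun t => f t x,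
    (ENNReal.monotone_rpow_of_nonneg hα.le).map_sup, ENNReal.mul_rpow_of_nonneg _ _ hα.le,
    ENNReal.mul_rpow_of_nonneg _ _ hα.le]
  have h : ∀ c : ℝ≥0, ((c ^ (1 / α) : ℝ≥0) : ℝ≥0∞) ^ α = c := fun c => by
    rw [ENNReal.coe_rpow_of_nonneg _ (by positivity), ← ENNReal.rpow_mul, one_div,
      inv_mul_cancel₀ hα.ne', ENNReal.rpow_one]
  rw [h, h]

/-- A discrete right derivative of `t ↦ max (t a) (n b)` at `t = n`. A tie `a = b` yields `a`, which
matches the closed boxes. -/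
theorem tendsto_sup_sub_sup (a b : ℝ≥0) :
    Tendsto (fun n : ℕ => ((n + 1 : ℕ) * (a : ℝ≥0∞)) ⊔ (n * (b : ℝ≥0∞)) -
      (n * (a : ℝ≥0∞)) ⊔ (n * (b : ℝ≥0∞))) atTop (nhds (if b ≤ a then (a : ℝ≥0∞) else 0)) := by
  split_ifs with h
  · refine tendsto_const_nhds.congr fun n => ?_
    have hb : (n : ℝ≥0∞) * b ≤ n * a := mul_le_mul_right (ENNReal.coe_le_coe.2 h) _
    have hc : (n : ℝ≥0∞) * a ≤ (n + 1 : ℕ) * a := mul_le_mul_left (by push_cast; exact le_self_add) _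
    rw [sup_eq_left.2 hb, sup_eq_left.2 (hb.trans hc)]
    push_cast
    rw [add_mul, one_mul, ENNReal.add_sub_cancel_left
      (ENNReal.mul_ne_top (ENNReal.natCast_ne_top n) ENNReal.coe_ne_top)]
  · rw [not_le] at h
    refine tendsto_const_nhds.congr' ?_
    -- The condition `n ≥ a / (b - a)` is exactly `(n + 1) a ≤ n b`, beyond which both maxima equal
    -- `n b`.
    obtain ⟨m, hm⟩ := exists_nat_ge ((a : ℝ) / (b - a))
    filter_upwards [eventually_ge_atTop m] with n hn
    have hba : (0 : ℝ) < b - a := sub_pos.2 h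
    have h1 : ((n : ℝ) + 1) * a ≤ n * b := by
      have : (a : ℝ) / (b - a) ≤ n := hm.trans (by exact_mod_cast hn)
      rw [div_le_iff₀ hba] at this
      linarith
    have h2 : ((n + 1 : ℕ) * (a : ℝ≥0∞)) ≤ n * (b : ℝ≥0∞) := by
      have : ((n : ℝ≥0) + 1) * a ≤ n * b := by exact_mod_cast h1
      have h3 : ((((n : ℝ≥0) + 1) * a : ℝ≥0) : ℝ≥0∞) ≤ ((n * b : ℝ≥0) : ℝ≥0∞) :=
        ENNReal.coe_le_coe.2 this
      push_cast at h3 ⊢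
      exact h3
    rw [sup_eq_right.2 h2]
    exact (tsub_eq_zero_of_le le_sup_right).symm

open Classical in
-- Raising the weight of `f t₀ ^ α` from `n` to `n + 1` changes the integrand, in the limit, only
-- where `f t₀` dominates every `c * f t`, that is, where the ratios lie in the box. The change
-- there is `f t₀ ^ α`, which also dominates all the differences.
theorem tendsto_exponent_sub_exponent (hα : 0 < α) (hf : ∀ t, MemLPlus α μ (f t)) (t₀ : T)
    (s : Finset (T × ℝ≥0)) :
    Tendsto (fun n : ℕ =>
      exponent α μ f (insert (t₀, ((n + 1 : ℕ) : ℝ≥0) ^ (1 / α)) (scaleCoeff ((n : ℝ≥0) ^ (1 / α)) s)) -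
      exponent α μ f (insert (t₀, (n : ℝ≥0) ^ (1 / α)) (scaleCoeff ((n : ℝ≥0) ^ (1 / α)) s)))
      atTop (nhds ((powMeasure α μ f t₀).map (ratioMap f t₀) (box s))) := by
  have hf1 := fun t => (hf t).1
  set A : S → ℝ≥0∞ := fun x => (s.sup fun p => (p.2 : ℝ≥0∞) * f p.1 x) ^ α with hA
  set B : S → ℝ≥0∞ := fun x => (f t₀ x : ℝ≥0∞) ^ α with hB
  have hAm : Measurable A := (measurable_finset_sup_mul hf1 s).pow_const α
  have hBm : Measurable B := (hf1 t₀).coe_nnreal_ennreal.pow_const α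
  have hE : ∀ m n : ℕ, exponent α μ f
      (insert (t₀, (m : ℝ≥0) ^ (1 / α)) (scaleCoeff ((n : ℝ≥0) ^ (1 / α)) s)) =
      ∫⁻ x, (m * B x) ⊔ (n * A x) ∂μ := fun m n => by
    rw [exponent_insert_scaleCoeff hα]
    simp only [ENNReal.coe_natCast, hA, hB]
  have hsupm : ∀ m n : ℕ, Measurable fun x => ((m : ℝ≥0∞) * B x) ⊔ (n * A x) := fun m n =>
    (hBm.const_mul _).sup (hAm.const_mul _)
  have hsub : ∀ n : ℕ,
      exponent α μ f (insert (t₀, ((n + 1 : ℕ) : ℝ≥0) ^ (1 / α)) (scaleCoeff ((n : ℝ≥0) ^ (1 / α)) s)) -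
      exponent α μ f (insert (t₀, (n : ℝ≥0) ^ (1 / α)) (scaleCoeff ((n : ℝ≥0) ^ (1 / α)) s)) =
      ∫⁻ x, ((n + 1 : ℕ) * B x) ⊔ (n * A x) - (n * B x) ⊔ (n * A x) ∂μ := fun n => by
    have hfin := exponent_lt_top hα hf
      (insert (t₀, (n : ℝ≥0) ^ (1 / α)) (scaleCoeff ((n : ℝ≥0) ^ (1 / α)) s))
    rw [hE] at hfin
    rw [hE, hE, lintegral_sub (hsupm n n) hfin.ne]
    refine ae_of_all _ fun x => sup_le_sup_right ?_ _
    exact mul_le_mul_left (by push_cast; exact le_self_add) _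
  simp_rw [hsub]
  have hbox : (powMeasure α μ f t₀).map (ratioMap f t₀) (box s) =
      ∫⁻ x, (if A x ≤ B x then B x else 0) ∂μ := by
    rw [Measure.map_apply (measurable_ratioMap hf1 t₀) (measurableSet_box s), powMeasure,
      withDensity_apply _ (measurable_ratioMap hf1 t₀ (measurableSet_box s)),
      ← lintegral_indicator (measurable_ratioMap hf1 t₀ (measurableSet_box s))]
    refine lintegral_congr fun x => ?_
    -- Where `f t₀` vanishes, all ratios are `0` by convention and the point falls in the box, but
    -- the density is `0` there.
    rcases eq_or_ne (f t₀ x) 0 with h0 | h0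
    · simp [indicator, hB, h0, hα]
    · have hiff : x ∈ ratioMap f t₀ ⁻¹' box s ↔ A x ≤ B x := by
        simp only [hA, hB]
        rw [ENNReal.rpow_le_rpow_iff hα, Finset.sup_le_iff]
        simp only [mem_preimage, box, mem_ofPred_eq, ratioMap]
        refine forall₂_congr fun p _ => ?_
        rw [← mul_div_assoc, div_le_one₀ (pos_iff_ne_zero.2 h0)]
        norm_cast
      by_cases hx : x ∈ ratioMap f t₀ ⁻¹' box s
      · rw [indicator_of_mem hx, if_pos (hiff.1 hx)]
      · rw [indicator_of_notMem hx, if_neg (fun h => hx (hiff.2 h))]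
  rw [hbox]
  refine tendsto_lintegral_of_dominated_convergence B
    (fun n => (hsupm (n + 1) n).sub (hsupm n n)) (fun n => ae_of_all _ fun x => ?_) (hf t₀).2.ne
    (ae_of_all _ fun x => ?_)
  · refine tsub_le_iff_left.2 (sup_le ?_ ?_)
    · push_cast
      rw [add_mul, one_mul]
      gcongr
      exact le_sup_left
    · exact le_sup_right.trans le_self_add
  · have hAfin : A x ≠ ∞ := by
      refine ENNReal.rpow_ne_top_of_nonneg hα.le (ne_of_lt ?_)
      refine (Finset.sup_lt_iff ENNReal.zero_lt_top).2 fun p _ => ?_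
      exact ENNReal.mul_lt_top ENNReal.coe_lt_top ENNReal.coe_lt_top
    have hBfin : B x ≠ ∞ := ENNReal.rpow_ne_top_of_nonneg hα.le ENNReal.coe_ne_top
    lift A x to ℝ≥0 using hAfin with a
    lift B x to ℝ≥0 using hBfin with b
    simpa only [ENNReal.coe_le_coe] using tendsto_sup_sub_sup b a

theorem map_ratioMap_eq_of_exponent_eq (hα : 0 < α) {S' : Type*} [MeasurableSpace S']
    {ν : Measure S'} {g : T → S' → ℝ≥0} (hf : ∀ t, MemLPlus α μ (f t))
    (hg : ∀ t, MemLPlus α ν (g t)) (h : exponent α μ f = exponent α ν g) (t₀ : T) :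
    (powMeasure α μ f t₀).map (ratioMap f t₀) = (powMeasure α ν g t₀).map (ratioMap g t₀) := by
  have := isFiniteMeasure_powMeasure hf t₀
  refine Measure.ext_of_box fun s => ?_
  have h1 := tendsto_exponent_sub_exponent hα hf t₀ s
  rw [h] at h1
  exact tendsto_nhds_unique h1 (tendsto_exponent_sub_exponent hα hg t₀ s)

/-- Where `f t₀ ≠ 0`, every ratio `f t / f u` is the quotient of `f t / f t₀` and `f u / f t₀`, so
the ratios to a single `f t₀` carry the whole trace of the ratio `σ`-field. -/
theorem exists_preimage_ratioMap {S : Type*} {f : T → S → ℝ≥0} {A : Set S} (hA : MeasurableSet[ratioSigmaField f] A) (t₀ : T) :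
    ∃ C : Set (T → ℝ≥0), MeasurableSet C ∧ ∀ x, f t₀ x ≠ 0 → (x ∈ A ↔ ratioMap f t₀ x ∈ C) := by
  set ι : {x // f t₀ x ≠ 0} → S := Subtype.val
  have hle : MeasurableSpace.comap ι (ratioSigmaField f) ≤
      MeasurableSpace.comap (ratioMap f t₀ ∘ ι) MeasurableSpace.pi := by
    simp only [ratioSigmaField, MeasurableSpace.comap_iSup, MeasurableSpace.comap_comp]
    refine iSup₂_le fun t u => ?_
    have h : (fun s => (f t s : ℝ≥0∞) / (f u s : ℝ≥0∞)) ∘ ι =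
        (fun y : T → ℝ≥0 => (y t : ℝ≥0∞) / (y u : ℝ≥0∞)) ∘ (ratioMap f t₀ ∘ ι) := by
      ext x
      have hx : (f t₀ x.1 : ℝ≥0∞) ≠ 0 := by simpa using x.2
      simp only [Function.comp, ratioMap, ι]
      rw [ENNReal.coe_div x.2, ENNReal.coe_div x.2,
        ENNReal.div_eq_inv_mul (a := (f t x.1 : ℝ≥0∞)) (b := f t₀ x.1),
        ENNReal.div_eq_inv_mul (a := (f u x.1 : ℝ≥0∞)) (b := f t₀ x.1),
        ENNReal.mul_div_mul_left _ _ (ENNReal.inv_ne_zero.2 ENNReal.coe_ne_top)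
          (ENNReal.inv_ne_top.2 hx)]
    rw [h, ← MeasurableSpace.comap_comp]
    refine MeasurableSpace.comap_mono (Measurable.comap_le ?_)
    have h1 : ∀ t, Measurable fun y : T → ℝ≥0 => (y t : ℝ≥0∞) := fun t =>
      (measurable_pi_apply t).coe_nnreal_ennreal
    exact (h1 t).div (h1 u)
  obtain ⟨C, hC, hCA⟩ := hle (ι ⁻¹' A) ⟨A, hA, rfl⟩
  refine ⟨C, hC, fun x hx => ?_⟩
  have := Set.ext_iff.1 hCA ⟨x, hx⟩
  exact this.symm

/-- Modulo null sets, the measurable sets on which `f t₀` does not vanish are the preimages under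
the ratio map. -/
theorem exists_preimage_ratioMap_ae_eq (hα : 0 < α) (hf : ∀ t, Measurable (f t))
    (hr : ∀ B : Set S, MeasurableSet B →
      ∃ A : Set S, MeasurableSet[ratioSigmaField f] A ∧ μ (symmDiff A B) = 0)
    (t₀ : T) {B : Set S} (hB : MeasurableSet B) :
    ∃ C : Set (T → ℝ≥0), MeasurableSet C ∧ ratioMap f t₀ ⁻¹' C =ᵐ[powMeasure α μ f t₀] B := by
  obtain ⟨A, hA, hAB⟩ := hr B hB
  obtain ⟨C, hC, hCA⟩ := exists_preimage_ratioMap hA t₀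
  refine ⟨C, hC, ?_⟩
  have h1 : A =ᵐ[powMeasure α μ f t₀] B :=
    (withDensity_absolutelyContinuous _ _).ae_eq (measure_symmDiff_eq_zero_iff.1 hAB)
  refine EventuallyEq.trans ?_ h1
  have h2 : ∀ᵐ x ∂(powMeasure α μ f t₀), f t₀ x ≠ 0 := by
    rw [powMeasure, ae_withDensity_iff ((hf t₀).coe_nnreal_ennreal.pow_const α)]
    refine ae_of_all _ fun x hx h0 => hx ?_
    simp [h0, hα]
  filter_upwards [h2] with x hx
  exact propext (hCA x hx).symm

theorem powMeasure_singleton [MeasurableSingletonClass S] (t₀ : T) (x : S) :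
    powMeasure α μ f t₀ {x} = (f t₀ x : ℝ≥0∞) ^ α * μ {x} := by
  rw [powMeasure, withDensity_apply _ (measurableSet_singleton x), lintegral_singleton]

/-- An atom of one minimal representation is matched by an atom of the other one. -/
theorem exists_matching_atom (hα : 0 < α) {S' : Type*} [MeasurableSpace S']
    [MeasurableSingletonClass S] [MeasurableSingletonClass S']
    [HasCountableSeparatingOn S' MeasurableSet univ]
    {ν : Measure S'} {g : T → S' → ℝ≥0} (hf : ∀ t, MemLPlus α μ (f t))
    (hg : ∀ t, MemLPlus α ν (g t)) (h : exponent α μ f = exponent α ν g)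
    (hrf : ∀ B : Set S, MeasurableSet B →
      ∃ A : Set S, MeasurableSet[ratioSigmaField f] A ∧ μ (symmDiff A B) = 0)
    (hrg : ∀ B : Set S', MeasurableSet B →
      ∃ A : Set S', MeasurableSet[ratioSigmaField g] A ∧ ν (symmDiff A B) = 0)
    {t₀ : T} {x : S} (hx : f t₀ x ≠ 0) (hμx : μ {x} ≠ 0) :
    ∃ y : S', ratioMap f t₀ x = ratioMap g t₀ y ∧
      (f t₀ x : ℝ≥0∞) ^ α * μ {x} = (g t₀ y : ℝ≥0∞) ^ α * ν {y} := by
  have hlaw := map_ratioMap_eq_of_exponent_eq hα hf hg h t₀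
  have hRm := measurable_ratioMap (fun t => (hf t).1) t₀
  have hQm := measurable_ratioMap (fun t => (hg t).1) t₀
  set m := powMeasure α μ f t₀ with hm
  set m' := powMeasure α ν g t₀ with hm'
  have hfin' : IsFiniteMeasure m' := isFiniteMeasure_powMeasure hg t₀
  obtain ⟨C, hC, hCx⟩ := exists_preimage_ratioMap_ae_eq hα (fun t => (hf t).1) hrf t₀
    (measurableSet_singleton x)
  -- `C` encodes the atom `x` through its ratios, and `D` is the set with the same code on the other
  -- space; equality of the ratio laws gives it the mass of `x`.
  set D := ratioMap g t₀ ⁻¹' C with hD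
  have hDm : MeasurableSet D := hQm hC
  have hmx : m {x} ≠ 0 := by
    rw [hm, powMeasure_singleton]
    refine mul_ne_zero ?_ hμx
    rw [Ne, ENNReal.rpow_eq_zero_iff_of_pos hα]
    simpa using hx
  -- the mass of `D` is concentrated on the sets that contain the image of `x`
  have key : ∀ C', MeasurableSet C' → m' (D ∩ ratioMap g t₀ ⁻¹' C') =
      m ({x} ∩ ratioMap f t₀ ⁻¹' C') := by
    intro C' hC'
    rw [hD, ← preimage_inter, ← Measure.map_apply hQm (hC.inter hC'), ← hlaw,
      Measure.map_apply hRm (hC.inter hC'), preimage_inter]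
    exact measure_congr (hCx.inter (ae_eq_refl _))
  have hDx : m' D = m {x} := by simpa using key univ MeasurableSet.univ
  have key1 : ∀ C', MeasurableSet C' → ratioMap f t₀ x ∈ C' →
      m' (D ∩ ratioMap g t₀ ⁻¹' C') = m {x} := by
    intro C' hC' hxC
    rw [key C' hC']
    congr 1
    exact inter_eq_left.2 (singleton_subset_iff.2 hxC)
  have key2 : ∀ C', MeasurableSet C' → ratioMap f t₀ x ∉ C' →
      m' (D ∩ ratioMap g t₀ ⁻¹' C') = 0 := by
    intro C' hC' hxC
    rw [key C' hC', (disjoint_singleton_left.2 hxC : Disjoint {x} (ratioMap f t₀ ⁻¹' C')).inter_eq,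
      measure_empty]
  have hne : Nonempty S' := by
    by_contra hne
    rw [not_nonempty_iff] at hne
    exact hmx (by rw [← hDx, Set.eq_empty_of_isEmpty D, measure_empty])
  obtain ⟨y, hy⟩ : ∃ y, {y} ∈ ae (m'.restrict D) := by
    -- By minimality each measurable `U` agrees with a preimage of some `C'`, so `U` fills `D` or
    -- misses it up to a null set, according as `C'` contains the ratio vector of `x` or not.
    -- Countable separation then isolates a point.
    refine exists_singleton_mem_of_forall_separating (MeasurableSet : Set S' → Prop) fun U hU => ?_
    obtain ⟨C', hC', hCU⟩ := exists_preimage_ratioMap_ae_eq hα (fun t => (hg t).1) hrg t₀ hU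
    have hU' : m' (D ∩ U) = m' (D ∩ ratioMap g t₀ ⁻¹' C') :=
      measure_congr ((ae_eq_refl D).inter hCU.symm)
    by_cases hxC : ratioMap f t₀ x ∈ C'
    · left
      rw [key1 C' hC' hxC, ← hDx] at hU'
      rw [mem_ae_iff, Measure.restrict_apply hU.compl, inter_comm, ← sdiff_eq]
      have := measure_inter_add_sdiff (μ := m') D hU
      rw [hU'] at this
      exact (ENNReal.add_right_inj (measure_ne_top m' D)).1 (this.trans (add_zero _).symm)
    · right
      rw [mem_ae_iff, compl_compl, Measure.restrict_apply hU, inter_comm, hU', key2 C' hC' hxC]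
  have hy0 : m' (D \ {y}) = 0 := by
    rw [mem_ae_iff, Measure.restrict_apply (measurableSet_singleton y).compl, inter_comm,
      ← sdiff_eq] at hy
    exact hy
  have hmem : ∀ E, m' (D ∩ E) ≠ 0 → y ∈ D ∩ E := by
    intro E hE
    by_contra hyE
    refine hE (measure_mono_null (t := D \ {y}) (fun z hz => ⟨hz.1, fun hzy => hyE ?_⟩) hy0)
    rw [mem_singleton_iff] at hzy
    rwa [← hzy]
  refine ⟨y, funext fun t => ?_, ?_⟩
  · have hC' : MeasurableSet {z : T → ℝ≥0 | z t = ratioMap f t₀ x t} :=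
      measurableSet_eq_fun (measurable_pi_apply t) measurable_const
    have h1 := hmem _ ((key1 _ hC' rfl).trans_ne hmx)
    exact (h1.2 : ratioMap g t₀ y t = ratioMap f t₀ x t).symm
  · rw [← powMeasure_singleton, ← powMeasure_singleton, ← hm, ← hm', ← hDx,
      ← measure_inter_add_sdiff D (measurableSet_singleton y), hy0, add_zero]
    congr 1
    have hyD : y ∈ D := (hmem D (by rw [inter_self, hDx]; exact hmx)).1
    exact inter_eq_right.2 (singleton_subset_iff.2 hyD)

/-- Atoms are separated by the functions of a minimal representation. -/
theorem eq_of_forall_eq_of_atom [MeasurableSingletonClass S]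
    (hr : ∀ B : Set S, MeasurableSet B →
      ∃ A : Set S, MeasurableSet[ratioSigmaField f] A ∧ μ (symmDiff A B) = 0)
    {x y : S} (hx : μ {x} ≠ 0) (hy : μ {y} ≠ 0) (hxy : ∀ t, f t x = f t y) : x = y := by
  obtain ⟨A, hA, hAx⟩ := hr {x} (measurableSet_singleton x)
  -- A null symmetric difference contains no atom. Membership in `A` depends only on the vector of
  -- values, so an atom with the same vector as `x` must be `x`.
  have hmem : ∀ z, μ {z} ≠ 0 → (z ∈ A ↔ z = x) := by
    intro z hz
    have hz' : z ∉ symmDiff A {x} := fun h =>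
      hz (measure_mono_null (singleton_subset_iff.2 h) hAx)
    rw [mem_symmDiff, mem_singleton_iff] at hz'
    tauto
  have hle : ratioSigmaField f ≤ MeasurableSpace.comap (fun z t => f t z) MeasurableSpace.pi := by
    refine iSup₂_le fun t u => ?_
    have h : (fun s => (f t s : ℝ≥0∞) / (f u s : ℝ≥0∞)) =
        (fun y : T → ℝ≥0 => (y t : ℝ≥0∞) / (y u : ℝ≥0∞)) ∘ fun z t => f t z := rfl
    rw [h, ← MeasurableSpace.comap_comp]
    refine MeasurableSpace.comap_mono (Measurable.comap_le ?_)
    have h1 : ∀ t, Measurable fun y : T → ℝ≥0 => (y t : ℝ≥0∞) := fun t =>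
      (measurable_pi_apply t).coe_nnreal_ennreal
    exact (h1 t).div (h1 u)
  obtain ⟨C, -, rfl⟩ := hle A hA
  have h1 := (hmem x hx).2 rfl
  have h2 : (fun t => f t y) ∈ C := by
    have : (fun t => f t x) = fun t => f t y := funext hxy
    rw [← this]
    exact h1
  exact ((hmem y hy).1 h2).symm

/-- If all the functions `f t` vanish almost everywhere on `E`, so does every element of the closed
max-linear span. -/
theorem closedMaxSpan_ae_eq_zero (hα : 0 < α) {E : Set S}
    (h0 : ∀ t, ∀ᵐ x ∂μ.restrict E, f t x = 0) {f₀ : S → ℝ≥0} (hf₀ : f₀ ∈ closedMaxSpan α μ f) :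
    ∀ᵐ x ∂μ.restrict E, f₀ x = 0 := by
  obtain ⟨hm, hclo⟩ := hf₀
  have h1 : ∫⁻ x in E, (f₀ x : ℝ≥0∞) ^ α ∂μ = 0 := by
    by_contra hne
    -- Taking `ε` equal to the mass of `f₀ ^ α` on `E` is contradictory: a max-linear combination
    -- vanishes almost everywhere on `E`, so its distance to `f₀` is at least this mass.
    obtain ⟨J, a, -, -, hlt⟩ := hclo _ (pos_iff_ne_zero.2 hne)
    refine hlt.not_ge ?_
    rw [rhoDist]
    refine le_trans ?_ (setLIntegral_le_lintegral E _)
    refine lintegral_mono_ae ?_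
    have h0' : ∀ᵐ x ∂μ.restrict E, ∀ t ∈ J, f t x = 0 :=
      (ae_ball_iff J.countable_toSet).2 fun t _ => h0 t
    filter_upwards [h0'] with x hx
    have hsup : (J.sup fun t => a t * f t x) = 0 := by
      rw [← nonpos_iff_eq_zero]
      exact Finset.sup_le fun t ht => by simp [hx t ht]
    rw [hsup, NNReal.coe_zero, Real.zero_rpow hα.ne', zero_sub, abs_neg,
      abs_of_nonneg (Real.rpow_nonneg (NNReal.coe_nonneg _) _), ← ENNReal.coe_rpow_of_nonneg _ hα.le,
      ← NNReal.coe_rpow, ENNReal.ofReal_coe_nnreal]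
  rw [lintegral_eq_zero_iff (hm.1.coe_nnreal_ennreal.pow_const α)] at h1
  filter_upwards [h1] with x hx
  simpa [ENNReal.rpow_eq_zero_iff_of_pos hα] using hx

/-- Applied below to a single integer and to the whole continuous part: on neither can all the `f t`
vanish. -/
theorem measure_eq_zero_of_full_support (hα : 0 < α) {E : Set S} (hE : MeasurableSet E)
    (h0 : ∀ t, ∀ᵐ x ∂μ.restrict E, f t x = 0)
    (hfs : ∃ f₀ ∈ closedMaxSpan α μ f, μ {s | f₀ s = 0} = 0) : μ E = 0 := by
  obtain ⟨f₀, hf₀, hz⟩ := hfs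
  have h1 := (ae_restrict_iff' hE).1 (closedMaxSpan_ae_eq_zero hα h0 hf₀)
  have h2 : ∀ᵐ x ∂μ, ¬ f₀ x = 0 := by
    rw [ae_iff]; simpa using hz
  rw [measure_eq_zero_iff_ae_notMem]
  filter_upwards [h1, h2] with x k1 k2 hx
  exact k2 (k1 hx)

end RatioLaw

/-! ### Restriction to a measurable part of the space -/

section Indicator

variable {T S : Type*} [MeasurableSpace S] {α : ℝ} {μ : Measure S}

theorem memLPlus_indicator (hα : 0 < α) {f : S → ℝ≥0} (hf : MemLPlus α μ f) {E : Set S}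
    (hE : MeasurableSet E) : MemLPlus α μ (E.indicator f) := by
  refine ⟨hf.1.indicator hE, lt_of_le_of_lt (lintegral_mono fun s => ?_) hf.2⟩
  refine ENNReal.rpow_le_rpow (ENNReal.coe_le_coe.2 ?_) hα.le
  exact indicator_le_self _ _ s

theorem exponent_indicator (hα : 0 < α) (f : T → S → ℝ≥0) {E : Set S} (hE : MeasurableSet E)
    (s : Finset (T × ℝ≥0)) :
    exponent α μ (fun t => E.indicator (f t)) s =
      ∫⁻ x in E, (s.sup fun p => (p.2 : ℝ≥0∞) * f p.1 x) ^ α ∂μ := by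
  rw [exponent, ← lintegral_indicator hE]
  refine lintegral_congr fun x => ?_
  by_cases hx : x ∈ E
  · simp [hx]
  · simp [hx, hα]

theorem exponent_indicator_add_indicator (hα : 0 < α) (f : T → S → ℝ≥0)
    {E F : Set S} (hE : MeasurableSet E) (hF : MeasurableSet F) (hEF : Eᶜ = F)
    (s : Finset (T × ℝ≥0)) :
    exponent α μ (fun t => E.indicator (f t)) s + exponent α μ (fun t => F.indicator (f t)) s =
      exponent α μ f s := by
  rw [exponent_indicator hα f hE, exponent_indicator hα f hF, ← hEF,
    lintegral_add_compl _ hE, exponent]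

end Indicator

section Embedding

variable {T Ω Ω' : Type*} {S S' : Type} [MeasurableSpace S] [MeasurableSpace S']
  [MeasurableSpace Ω] [MeasurableSpace Ω'] {α : ℝ} {P : Measure Ω} {P' : Measure Ω'}
  {μ : Measure S} {μ' : Measure S'} {e : S' → S}

theorem lintegral_comp_embedding (he : MeasurableEmbedding e)
    (hμ : μ'.map e = μ.restrict (range e)) (h : S → ℝ≥0∞) :
    ∫⁻ x, h (e x) ∂μ' = ∫⁻ x in range e, h x ∂μ := by
  rw [← hμ, he.lintegral_map]

theorem measure_image_embedding (he : MeasurableEmbedding e)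
    (hμ : μ'.map e = μ.restrict (range e)) (A : Set S') : μ (e '' A) = μ' A := by
  have h : (μ'.map e) (e '' A) = μ' A := by
    rw [he.map_apply, he.injective.preimage_image]
  rw [← h, hμ, Measure.restrict_apply' he.measurableSet_range,
    inter_eq_left.2 (image_subset_range e A)]

theorem memLPlus_comp_embedding (he : MeasurableEmbedding e)
    (hμ : μ'.map e = μ.restrict (range e)) {f : S → ℝ≥0} (hf : MemLPlus α μ f) :
    MemLPlus α μ' (f ∘ e) := by
  refine ⟨hf.1.comp he.measurable, ?_⟩
  have := lintegral_comp_embedding he hμ fun x => (f x : ℝ≥0∞) ^ α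
  exact this.trans_lt ((setLIntegral_le_lintegral _ _).trans_lt hf.2)

theorem exponent_comp_embedding (hα : 0 < α) (he : MeasurableEmbedding e)
    (hμ : μ'.map e = μ.restrict (range e)) (f : T → S → ℝ≥0) :
    exponent α μ' (fun t => f t ∘ e) = exponent α μ (fun t => (range e).indicator (f t)) := by
  ext s
  rw [exponent_indicator hα f he.measurableSet_range]
  exact lintegral_comp_embedding he hμ fun x => (s.sup fun p => (p.2 : ℝ≥0∞) * f p.1 x) ^ α

theorem IsRandomSupMeasure.comp_embedding {M : Set S → Ω → ℝ≥0∞}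
    (hM : IsRandomSupMeasure α P μ M) (he : MeasurableEmbedding e)
    (hμ : μ'.map e = μ.restrict (range e)) :
    IsRandomSupMeasure α P μ' fun A => M (e '' A) where
  indep n A hA hd := hM.indep n (fun i => e '' A i) (fun i => he.measurableSet_image.2 (hA i))
    fun _ _ hij => disjoint_image_of_injective he.injective (hd hij)
  frechet A hA := by
    rw [← measure_image_embedding he hμ]
    exact hM.frechet _ (he.measurableSet_image.2 hA)
  sup_additive A hA hd := by
    rw [image_iUnion]
    exact hM.sup_additive (fun i => e '' A i) (fun i => he.measurableSet_image.2 (hA i))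
      fun _ _ hij => disjoint_image_of_injective he.injective (hd hij)

theorem rhoDist_comp_embedding_le (he : MeasurableEmbedding e)
    (hμ : μ'.map e = μ.restrict (range e)) (f g : S → ℝ≥0) :
    rhoDist α μ' (f ∘ e) (g ∘ e) ≤ rhoDist α μ f g := by
  have := lintegral_comp_embedding he hμ fun s => ENNReal.ofReal |(f s : ℝ) ^ α - (g s : ℝ) ^ α|
  exact this.trans_le (setLIntegral_le_lintegral _ _)

theorem comp_embedding_mem_closedMaxSpan (he : MeasurableEmbedding e)
    (hμ : μ'.map e = μ.restrict (range e)) {f : T → S → ℝ≥0} {h : S → ℝ≥0}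
    (hh : h ∈ closedMaxSpan α μ f) : h ∘ e ∈ closedMaxSpan α μ' fun t => f t ∘ e := by
  refine ⟨memLPlus_comp_embedding he hμ hh.1, fun ε hε => ?_⟩
  obtain ⟨J, a, hJ, ha, hlt⟩ := hh.2 ε hε
  exact ⟨J, a, hJ, ha, (rhoDist_comp_embedding_le he hμ
    (fun s => J.sup fun t => a t * f t s) h).trans_lt hlt⟩

theorem comap_ratioSigmaField {T S S' : Type*} (f : T → S → ℝ≥0) (e : S' → S) :
    MeasurableSpace.comap e (ratioSigmaField f) = ratioSigmaField fun t => f t ∘ e := by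
  simp only [ratioSigmaField, MeasurableSpace.comap_iSup, MeasurableSpace.comap_comp]
  rfl

/-- The restriction of a minimal representation to a measurable part of the space is a minimal
representation of any process with the corresponding exponent. -/
theorem IsMinimalRepresentation.comp_embedding [IsProbabilityMeasure P'] (hα : 0 < α)
    {X : T → Ω → ℝ} {Y : T → Ω' → ℝ} {f : T → S → ℝ≥0}
    (hf : IsMinimalRepresentation α P X μ f) (he : MeasurableEmbedding e)
    (hμ : μ'.map e = μ.restrict (range e))
    (hY : HasExponent P' Y (exponent α μ fun t => (range e).indicator (f t))) :
    IsMinimalRepresentation α P' Y μ' fun t => f t ∘ e where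
  spectral := by
    -- The sup-measure of the given representation is restricted to the image of `e`; `Y` may live
    -- on another probability space and enters only through its exponent.
    obtain ⟨hm, Ω₀, _, P₀, _, M, hM, -⟩ := hf.spectral
    have hm' : ∀ t, MemLPlus α μ' (f t ∘ e) := fun t => memLPlus_comp_embedding he hμ (hm t)
    have hM' := hM.comp_embedding he hμ
    refine ⟨hm', Ω₀, _, P₀, ‹_›, _, hM', ?_⟩
    rw [← exponent_comp_embedding hα he hμ f] at hY
    exact hY.eqInDist (hM'.hasExponent hα hm')
  full_support := by
    obtain ⟨f₀, h1, h2⟩ := hf.full_support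
    refine ⟨f₀ ∘ e, comp_embedding_mem_closedMaxSpan he hμ h1, ?_⟩
    rw [← measure_image_embedding he hμ]
    refine measure_mono_null ?_ h2
    rintro _ ⟨x, hx, rfl⟩
    exact hx
  ratio B hB := by
    obtain ⟨A, hA, hAB⟩ := hf.ratio (e '' B) (he.measurableSet_image.2 hB)
    refine ⟨e ⁻¹' A, ?_, ?_⟩
    · rw [← comap_ratioSigmaField]
      exact ⟨A, hA, rfl⟩
    · rw [← measure_image_embedding he hμ]
      refine measure_mono_null ?_ hAB
      rintro _ ⟨x, hx, rfl⟩
      rw [mem_symmDiff] at hx ⊢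
      rwa [he.injective.mem_set_image]

end Embedding

/-! ### The standard spaces -/

section Standard

variable {I J : Bool} {N K : ℕ∞}

/-- Lebesgue measure on `(0,1)` plus counting measure on the integers. -/
noncomputable def baseMeasure : Measure ℝ :=
  (volume : Measure ℝ).restrict (Ioo 0 1) + Measure.count.restrict (range fun n : ℕ => (n : ℝ))

theorem measurableSet_range_natCast : MeasurableSet (range fun n : ℕ => (n : ℝ)) :=
  (countable_range _).measurableSet

theorem measurableSet_stdSet (I : Bool) (N : ℕ∞) : MeasurableSet (stdSet I N) := by
  refine MeasurableSet.union ?_ ?_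
  · cases I
    · simp
    · have h : {x : ℝ | true = true ∧ x ∈ Ioo (0 : ℝ) 1} = Ioo 0 1 := by ext x; simp
      rw [h]
      exact measurableSet_Ioo
  · refine ((countable_range fun n : ℕ => (n : ℝ)).mono ?_).measurableSet
    rintro x ⟨n, -, -, rfl⟩
    exact ⟨n, rfl⟩

theorem stdMeasure_apply (A : Set (StdSpace I N)) :
    stdMeasure I N A = baseMeasure (Subtype.val '' A) :=
  (MeasurableEmbedding.subtype_coe (measurableSet_stdSet I N)).comap_apply _ _

theorem measurableSet_contPart : MeasurableSet (contPart I N) :=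
  measurable_subtype_coe (measurableSet_Ioo (a := (0 : ℝ)) (b := 1))

theorem measurableSet_discPart : MeasurableSet (discPart I N) :=
  measurable_subtype_coe measurableSet_range_natCast

theorem disjoint_Ioo_range_natCast :
    Disjoint (Ioo (0 : ℝ) 1) (range fun n : ℕ => (n : ℝ)) := by
  rw [Set.disjoint_left]
  rintro x ⟨h1, h2⟩ ⟨n, hn⟩
  simp only at hn
  rw [← hn] at h1 h2
  have h3 : 0 < n := by exact_mod_cast h1
  have h4 : n < 1 := by exact_mod_cast h2
  omega

theorem compl_contPart : (contPart I N)ᶜ = discPart I N := by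
  ext x
  constructor
  · intro hx
    rcases x.2 with h | ⟨n, -, -, hn⟩
    · exact absurd h.2 hx
    · exact ⟨n, hn.symm⟩
  · intro hx hx'
    exact Set.disjoint_left.1 disjoint_Ioo_range_natCast hx' hx

open Classical in
theorem stdMeasure_singleton (x : StdSpace I N) :
    stdMeasure I N {x} = if (x : ℝ) ∈ range (fun n : ℕ => (n : ℝ)) then 1 else 0 := by
  rw [stdMeasure_apply, image_singleton, baseMeasure, Measure.add_apply,
    Measure.restrict_apply (measurableSet_singleton _),
    Measure.restrict_apply (measurableSet_singleton _),
    measure_mono_null inter_subset_left (measure_singleton _), zero_add]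
  split_ifs with h
  · rw [inter_eq_left.2 (singleton_subset_iff.2 h), Measure.count_singleton]
  · rw [singleton_inter_eq_empty.2 h, measure_empty]

theorem stdMeasure_singleton_of_mem {x : StdSpace I N} (hx : x ∈ discPart I N) :
    stdMeasure I N {x} = 1 := by
  rw [stdMeasure_singleton]
  exact if_pos hx

theorem mem_discPart_of_stdMeasure_ne_zero {x : StdSpace I N} (hx : stdMeasure I N {x} ≠ 0) :
    x ∈ discPart I N := by
  rw [stdMeasure_singleton] at hx
  by_contra h
  exact hx (if_neg h)

theorem stdMeasure_contPart_true : stdMeasure true N (contPart true N) ≠ 0 := by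
  have h : Subtype.val '' contPart true N = Ioo (0 : ℝ) 1 := by
    ext x
    constructor
    · rintro ⟨y, hy, rfl⟩
      exact hy
    · intro hx
      exact ⟨⟨x, Or.inl ⟨rfl, hx⟩⟩, hx, rfl⟩
  rw [stdMeasure_apply, h, baseMeasure, Measure.add_apply, Measure.restrict_apply_self]
  simp

theorem contPart_false : contPart false N = ∅ := by
  rw [← compl_compl (contPart false N), compl_contPart, compl_empty_iff, eq_univ_iff_forall]
  intro x
  rcases x.2 with h | ⟨n, -, -, hn⟩
  · exact absurd h.1 (by simp)
  · exact ⟨n, hn.symm⟩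

theorem countable_discPart : (discPart I N).Countable :=
  (countable_range fun n : ℕ => (n : ℝ)).preimage Subtype.val_injective

theorem encard_discPart : (discPart I N).encard = N := by
  rw [← Subtype.val_injective.encard_image]
  have h1 : Subtype.val '' discPart I N = (fun n : ℕ => (n : ℝ)) '' {n | 1 ≤ n ∧ (n : ℕ∞) ≤ N} := by
    ext x
    constructor
    · rintro ⟨⟨y, hy⟩, ⟨n, hn⟩, rfl⟩
      rcases hy with h | ⟨k, hk1, hk2, hk⟩
      · exact absurd ⟨n, hn⟩ (Set.disjoint_left.1 disjoint_Ioo_range_natCast h.2)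
      · exact ⟨k, ⟨hk1, hk2⟩, hk.symm⟩
    · rintro ⟨n, ⟨h1, h2⟩, rfl⟩
      exact ⟨⟨n, Or.inr ⟨n, h1, h2, rfl⟩⟩, ⟨n, rfl⟩, rfl⟩
  rw [h1, Function.Injective.encard_image Nat.cast_injective]
  induction N with
  | top =>
    rw [Set.encard_eq_top_iff]
    refine (Set.Ici_infinite 1).mono fun n hn => ⟨hn, le_top⟩
  | coe N =>
    have h2 : {n : ℕ | 1 ≤ n ∧ (n : ℕ∞) ≤ N} = (Finset.Icc 1 N : Finset ℕ) := by
      ext n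
      simp
    rw [h2, Set.encard_coe_eq_coe_finsetCard, Nat.card_Icc, Nat.add_sub_cancel]

theorem measurableEmbedding_inclusion (h : stdSet J K ⊆ stdSet I N) :
    MeasurableEmbedding (inclusion h) where
  injective := inclusion_injective h
  measurable := measurable_subtype_coe.subtype_mk
  measurableSet_image' A hA := by
    have : inclusion h '' A = Subtype.val ⁻¹' (Subtype.val '' A) := by
      ext x
      constructor
      · rintro ⟨y, hy, rfl⟩
        exact ⟨y, hy, rfl⟩
      · rintro ⟨y, hy, hyx⟩
        exact ⟨y, hy, Subtype.ext hyx⟩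
    rw [this]
    exact measurable_subtype_coe
      ((MeasurableEmbedding.subtype_coe (measurableSet_stdSet J K)).measurableSet_image.2 hA)

theorem map_inclusion_stdMeasure (h : stdSet J K ⊆ stdSet I N) :
    (stdMeasure J K).map (inclusion h) = (stdMeasure I N).restrict (range (inclusion h)) := by
  have he := measurableEmbedding_inclusion h
  ext A hA
  rw [Measure.map_apply he.measurable hA, Measure.restrict_apply hA, stdMeasure_apply,
    stdMeasure_apply]
  congr 1
  ext x
  constructor
  · rintro ⟨y, hy, rfl⟩
    exact ⟨inclusion h y, ⟨hy, y, rfl⟩, rfl⟩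
  · rintro ⟨_, ⟨hy, y, rfl⟩, rfl⟩
    exact ⟨y, hy, rfl⟩

end Standard

/-! ### Uniqueness of the standardized support -/

section Uniqueness

variable {T : Type*} {I J : Bool} {N K : ℕ∞} {α : ℝ} {f : T → StdSpace I N → ℝ≥0}
  {g : T → StdSpace J K → ℝ≥0}

/-- Matched points have equal ratios, which fixes their vectors up to a factor. Unit masses turn
equality of the weighted masses into `f t₀ x = g t₀ y`, so the factor is `1`. -/
theorem IsMinimalRepresentation.image_discPart_subset {Ω Ω' : Type*} [MeasurableSpace Ω]
    [MeasurableSpace Ω'] {P : Measure Ω} {P' : Measure Ω'} {X : T → Ω → ℝ} {Y : T → Ω' → ℝ}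
    (hα : 0 < α) (hf : IsMinimalRepresentation α P X (stdMeasure I N) f)
    (hg : IsMinimalRepresentation α P' Y (stdMeasure J K) g)
    (h : exponent α (stdMeasure I N) f = exponent α (stdMeasure J K) g) :
    (fun x t => f t x) '' discPart I N ⊆ (fun y t => g t y) '' discPart J K := by
  rintro _ ⟨x, hx, rfl⟩
  have hx1 := stdMeasure_singleton_of_mem hx
  obtain ⟨t₀, ht₀⟩ : ∃ t₀, f t₀ x ≠ 0 := by
    by_contra! h0
    have hx0 := measure_eq_zero_of_full_support hα (measurableSet_singleton x) (fun t => by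
      rw [ae_restrict_iff' (measurableSet_singleton x)]
      exact ae_of_all _ fun y hy => by rw [mem_singleton_iff.1 hy]; exact h0 t) hf.full_support
    rw [hx1] at hx0
    exact one_ne_zero hx0
  obtain ⟨y, hy1, hy2⟩ := exists_matching_atom hα hf.spectral.1 hg.spectral.1 h hf.ratio hg.ratio
    ht₀ (by rw [hx1]; exact one_ne_zero)
  have hfx : (f t₀ x : ℝ≥0∞) ^ α ≠ 0 := by
    rw [Ne, ENNReal.rpow_eq_zero_iff_of_pos hα]
    simpa using ht₀
  rw [hx1, mul_one] at hy2
  -- The matched point has positive mass, and only integers do.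
  have hy : y ∈ discPart J K := mem_discPart_of_stdMeasure_ne_zero (by
    rw [hy2] at hfx
    exact right_ne_zero_of_mul hfx)
  rw [stdMeasure_singleton_of_mem hy, mul_one] at hy2
  have hval : f t₀ x = g t₀ y := by
    exact_mod_cast (ENNReal.rpow_left_injective hα.ne') hy2
  refine ⟨y, hy, funext fun t => ?_⟩
  have ht := congrFun hy1 t
  simp only [ratioMap] at ht
  rw [← hval, div_left_inj' ht₀] at ht
  exact ht.symm

theorem IsMinimalRepresentation.injOn_discPart {Ω : Type*} [MeasurableSpace Ω] {P : Measure Ω}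
    {X : T → Ω → ℝ} (hf : IsMinimalRepresentation α P X (stdMeasure I N) f) :
    InjOn (fun x t => f t x) (discPart I N) := fun x hx y hy hxy =>
  eq_of_forall_eq_of_atom (μ := stdMeasure I N) hf.ratio
    (by rw [stdMeasure_singleton_of_mem hx]; exact one_ne_zero)
    (by rw [stdMeasure_singleton_of_mem hy]; exact one_ne_zero) (congrFun hxy)

/-- Since distinct integers carry distinct vectors, the discrete exponent depends only on the set of
vectors, not on its enumeration. -/
theorem IsMinimalRepresentation.exponent_indicator_discPart {Ω : Type*} [MeasurableSpace Ω]
    {P : Measure Ω} {X : T → Ω → ℝ} (hα : 0 < α)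
    (hf : IsMinimalRepresentation α P X (stdMeasure I N) f) (s : Finset (T × ℝ≥0)) :
    exponent α (stdMeasure I N) (fun t => (discPart I N).indicator (f t)) s =
      ∑' v : (fun x t => f t x) '' discPart I N,
        (s.sup fun p => (p.2 : ℝ≥0∞) * (v : T → ℝ≥0) p.1) ^ α := by
  rw [exponent_indicator hα _ measurableSet_discPart, lintegral_countable _ countable_discPart,
    tsum_image (fun v : T → ℝ≥0 => (s.sup fun p => (p.2 : ℝ≥0∞) * v p.1) ^ α) hf.injOn_discPart]
  refine tsum_congr fun x => ?_
  rw [stdMeasure_singleton_of_mem x.2, mul_one]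

/-- If the continuous exponent were zero, all `f t` would vanish almost everywhere on `(0,1)`, a set
of positive measure, against full support. -/
theorem IsMinimalRepresentation.exists_exponent_indicator_contPart_ne_zero {Ω : Type*}
    [MeasurableSpace Ω] {P : Measure Ω} {X : T → Ω → ℝ} (hα : 0 < α)
    {f : T → StdSpace true N → ℝ≥0} (hf : IsMinimalRepresentation α P X (stdMeasure true N) f) :
    ∃ s, exponent α (stdMeasure true N) (fun t => (contPart true N).indicator (f t)) s ≠ 0 := by
  by_contra! h
  refine stdMeasure_contPart_true (N := N) (measure_eq_zero_of_full_support hα measurableSet_contPart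
    (fun t => ?_) hf.full_support)
  have ht := h {(t, 1)}
  rw [exponent_indicator hα _ measurableSet_contPart] at ht
  simp only [Finset.sup_singleton, ENNReal.coe_one, one_mul] at ht
  rw [lintegral_eq_zero_iff ((hf.spectral.1 t).1.coe_nnreal_ennreal.pow_const α)] at ht
  filter_upwards [ht] with x hx
  simpa [ENNReal.rpow_eq_zero_iff_of_pos hα] using hx

/-- Two minimal representations with standardized supports and the same exponent have the same
standardized support, and the same exponents of their continuous and discrete parts. -/
theorem IsMinimalRepresentation.unique {Ω Ω' : Type*} [MeasurableSpace Ω]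
    [MeasurableSpace Ω'] {P : Measure Ω} {P' : Measure Ω'} {X : T → Ω → ℝ} {Y : T → Ω' → ℝ}
    (hα : 0 < α) (hf : IsMinimalRepresentation α P X (stdMeasure I N) f)
    (hg : IsMinimalRepresentation α P' Y (stdMeasure J K) g)
    (h : exponent α (stdMeasure I N) f = exponent α (stdMeasure J K) g) :
    J = I ∧ K = N ∧
      exponent α (stdMeasure I N) (fun t => (contPart I N).indicator (f t)) =
        exponent α (stdMeasure J K) (fun t => (contPart J K).indicator (g t)) ∧
      exponent α (stdMeasure I N) (fun t => (discPart I N).indicator (f t)) =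
        exponent α (stdMeasure J K) (fun t => (discPart J K).indicator (g t)) := by
  have himg : (fun x t => f t x) '' discPart I N = (fun y t => g t y) '' discPart J K :=
    (hf.image_discPart_subset hα hg h).antisymm (hg.image_discPart_subset hα hf h.symm)
  have hdisc : exponent α (stdMeasure I N) (fun t => (discPart I N).indicator (f t)) =
      exponent α (stdMeasure J K) (fun t => (discPart J K).indicator (g t)) := by
    ext s
    rw [hf.exponent_indicator_discPart hα, hg.exponent_indicator_discPart hα, himg]
  have hcont : exponent α (stdMeasure I N) (fun t => (contPart I N).indicator (f t)) =
      exponent α (stdMeasure J K) (fun t => (contPart J K).indicator (g t)) := by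
    ext s
    have h1 := exponent_indicator_add_indicator (μ := stdMeasure I N) hα f measurableSet_contPart
      measurableSet_discPart compl_contPart s
    have h2 := exponent_indicator_add_indicator (μ := stdMeasure J K) hα g measurableSet_contPart
      measurableSet_discPart compl_contPart s
    rw [h, ← h2, hdisc] at h1
    -- The discrete exponent is finite, so it can be cancelled from the equal totals.
    exact (ENNReal.add_left_inj (exponent_lt_top hα
      (fun t => memLPlus_indicator hα (hg.spectral.1 t) measurableSet_discPart) s).ne).1 h1
  refine ⟨?_, ?_, hcont, hdisc⟩
  · cases I <;> cases J
    · rfl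
    · obtain ⟨s, hs⟩ := hg.exists_exponent_indicator_contPart_ne_zero hα
      rw [← hcont, contPart_false] at hs
      simp [exponent, hα] at hs
    · obtain ⟨s, hs⟩ := hf.exists_exponent_indicator_contPart_ne_zero hα
      rw [hcont, contPart_false] at hs
      simp [exponent, hα] at hs
    · rfl
  · rw [← encard_discPart (I := I) (N := N), ← encard_discPart (I := J) (N := K),
      ← hf.injOn_discPart.encard_image, ← hg.injOn_discPart.encard_image, himg]

/-- Two spectral representations of the same process have the same exponent. -/
theorem IsSpectralRepresentation.exponent_eq {Ω : Type*} [MeasurableSpace Ω] {P : Measure Ω}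
    {X : T → Ω → ℝ} {S S' : Type} [MeasurableSpace S] [MeasurableSpace S'] {μ : Measure S}
    {ν : Measure S'} {f : T → S → ℝ≥0} {g : T → S' → ℝ≥0} (hα : 0 < α)
    (hf : IsSpectralRepresentation α P X μ f) (hg : IsSpectralRepresentation α P X ν g) :
    exponent α μ f = exponent α ν g := by
  obtain ⟨hfm, Ω₁, _, P₁, _, M₁, hM₁, h1⟩ := hf
  obtain ⟨hgm, Ω₂, _, P₂, _, M₂, hM₂, h2⟩ := hg
  exact (hM₁.hasExponent hα hfm).exponent_eq (hM₂.hasExponent hα hgm)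
    (IdentDistrib.trans (IdentDistrib.symm h1) h2)

theorem range_inclusion_contPart (h : stdSet I 0 ⊆ stdSet I N) :
    range (inclusion h) = contPart I N := by
  rw [range_inclusion]
  ext x
  refine ⟨fun hx => ?_, fun hx => (stdSet_inter_Ioo I N).subset ⟨x.2, hx⟩⟩
  exact ((stdSet_inter_Ioo I N).symm.subset hx).2

theorem range_inclusion_discPart (h : stdSet false N ⊆ stdSet I N) :
    range (inclusion h) = discPart I N := by
  rw [range_inclusion]
  ext x
  refine ⟨fun hx => ?_, fun hx => (stdSet_inter_range I N).subset ⟨x.2, hx⟩⟩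
  exact ((stdSet_inter_range I N).symm.subset hx).2

/-- A minimal representation of a process over a standard space yields the standardized support. -/
theorem IsMinimalRepresentation.hasStandardizedSupport {Ω : Type*} [MeasurableSpace Ω]
    {P : Measure Ω} {X : T → Ω → ℝ} (hα : 0 < α)
    (hf : IsMinimalRepresentation α P X (stdMeasure I N) f) :
    HasStandardizedSupport α P X I N := by
  refine ⟨⟨f, hf⟩, fun J K g hg => ?_⟩
  have h := hf.unique hα hg (hf.spectral.exponent_eq hα hg.spectral)
  exact ⟨h.1, h.2.1⟩

end Uniqueness

/-! ### The continuous and discrete components -/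

section Components

variable {T Ω Ω₁ : Type*} [MeasurableSpace Ω] [MeasurableSpace Ω₁] {P : Measure Ω}
  {P₁ : Measure Ω₁} [IsProbabilityMeasure P₁] {α : ℝ} {X : T → Ω → ℝ} {I : Bool} {N : ℕ∞}
  {f : T → StdSpace I N → ℝ≥0} {M : Set (StdSpace I N) → Ω₁ → ℝ≥0∞}

theorem hasExponent_contComponent (hα : 0 < α) (hM : IsRandomSupMeasure α P₁ (stdMeasure I N) M)
    (hf : ∀ t, MemLPlus α (stdMeasure I N) (f t)) :
    HasExponent P₁ (contComponent α P₁ M f)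
      (exponent α (stdMeasure I N) fun t => (contPart I N).indicator (f t)) :=
  hM.hasExponent hα fun t => memLPlus_indicator hα (hf t) measurableSet_contPart

theorem hasExponent_discComponent (hα : 0 < α) (hM : IsRandomSupMeasure α P₁ (stdMeasure I N) M)
    (hf : ∀ t, MemLPlus α (stdMeasure I N) (f t)) :
    HasExponent P₁ (discComponent α P₁ M f)
      (exponent α (stdMeasure I N) fun t => (discPart I N).indicator (f t)) :=
  hM.hasExponent hα fun t => memLPlus_indicator hα (hf t) measurableSet_discPart

theorem contComponent_sup_discComponent_ae_eq (hα : 0 < α)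
    (hM : IsRandomSupMeasure α P₁ (stdMeasure I N) M)
    (hf : ∀ t, MemLPlus α (stdMeasure I N) (f t)) (t : T) :
    (fun ω => contComponent α P₁ M f t ω ⊔ discComponent α P₁ M f t ω) =ᵐ[P₁]
      extremalIntegral α P₁ (stdMeasure I N) M (f t) := by
  have hc := memLPlus_indicator hα (hf t) (measurableSet_contPart (I := I) (N := N))
  have hd := memLPlus_indicator hα (hf t) (measurableSet_discPart (I := I) (N := N))
  filter_upwards [hM.extremalIntegral_ae_eq hα hc, hM.extremalIntegral_ae_eq hα hd,
    hM.extremalIntegral_ae_eq hα (hf t), hM.supIntegral_lt_top hα hc, hM.supIntegral_lt_top hα hd,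
    hM.supIntegral_sup hα hc.1.coe_nnreal_ennreal hd.1.coe_nnreal_ennreal] with ω h1 h2 h3 h4 h5 h6
  rw [contComponent, discComponent, h1, h2, h3, ← ENNReal.toReal_max h4.ne h5.ne, ← h6]
  congr 2
  ext x
  by_cases hx : x ∈ contPart I N
  · have hx' : x ∉ discPart I N := by
      rw [← compl_contPart]
      exact fun h => h hx
    simp [hx, hx']
  · have hx' : x ∈ discPart I N := by
      rw [← compl_contPart]
      exact hx
    simp [hx, hx']

end Components

/-! ### The decomposition theorem -/

theorem theorem5p1 {T Ω Ω₁ : Type*} [MeasurableSpace Ω] [MeasurableSpace Ω₁]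
    (P : Measure Ω) [IsProbabilityMeasure P] (α : ℝ) (hα : 0 < α)
    (X : T → Ω → ℝ) (hX : IsFrechetProcess α P X)
    (I : Bool) (N : ℕ∞) (f : T → StdSpace I N → ℝ≥0)
    (hf : IsMinimalRepresentation α P X (stdMeasure I N) f)
    (P₁ : Measure Ω₁) [IsProbabilityMeasure P₁] (M : Set (StdSpace I N) → Ω₁ → ℝ≥0∞)
    (hM : IsRandomSupMeasure α P₁ (stdMeasure I N) M) :
    -- the decomposition
    EqInDist P P₁ X (fun t ω => contComponent α P₁ M f t ω ⊔ discComponent α P₁ M f t ω) ∧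
    IsFrechetProcess α P₁ (contComponent α P₁ M f) ∧
    IsFrechetProcess α P₁ (discComponent α P₁ M f) ∧
    -- uniqueness in distribution
    (∀ (J : Bool) (K : ℕ∞) (g : T → StdSpace J K → ℝ≥0),
      IsMinimalRepresentation α P X (stdMeasure J K) g →
      J = I ∧ K = N ∧
      ∀ (Ω₂ : Type*) [MeasurableSpace Ω₂] (P₂ : Measure Ω₂) [IsProbabilityMeasure P₂]
        (M₂ : Set (StdSpace J K) → Ω₂ → ℝ≥0∞),
        IsRandomSupMeasure α P₂ (stdMeasure J K) M₂ →
        EqInDist P₁ P₂ (contComponent α P₁ M f) (contComponent α P₂ M₂ g) ∧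
        EqInDist P₁ P₂ (discComponent α P₁ M f) (discComponent α P₂ M₂ g)) ∧
    -- independence and standardized supports
    IndepFun (path (contComponent α P₁ M f)) (path (discComponent α P₁ M f)) P₁ ∧
    HasStandardizedSupport α P₁ (contComponent α P₁ M f) I 0 ∧
    HasStandardizedSupport α P₁ (discComponent α P₁ M f) false N ∧
    -- minimality of the restrictions
    IsMinimalRepresentation α P₁ (contComponent α P₁ M f) (stdMeasure I 0) (restrictCont f) ∧
    IsMinimalRepresentation α P₁ (discComponent α P₁ M f) (stdMeasure false N)
      (restrictDisc f) := by
  have hfm := hf.spectral.1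
  have hc := hasExponent_contComponent hα hM hfm
  have hd := hasExponent_discComponent hα hM hfm
  have hsubc : stdSet I 0 ⊆ stdSet I N := fun x hx => ((stdSet_inter_Ioo I N).symm.subset hx).1
  have hsubd : stdSet false N ⊆ stdSet I N := fun x hx =>
    ((stdSet_inter_range I N).symm.subset hx).1
  have hminc : IsMinimalRepresentation α P₁ (contComponent α P₁ M f) (stdMeasure I 0)
      (restrictCont f) := by
    refine hf.comp_embedding (e := inclusion hsubc) hα (measurableEmbedding_inclusion hsubc)
      (map_inclusion_stdMeasure hsubc) ?_
    rw [range_inclusion_contPart]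
    exact hc
  have hmind : IsMinimalRepresentation α P₁ (discComponent α P₁ M f) (stdMeasure false N)
      (restrictDisc f) := by
    refine hf.comp_embedding (e := inclusion hsubd) hα (measurableEmbedding_inclusion hsubd)
      (map_inclusion_stdMeasure hsubd) ?_
    rw [range_inclusion_discPart]
    exact hd
  refine ⟨?_, hc.isFrechetProcess hα fun t => memLPlus_indicator hα (hfm t) measurableSet_contPart,
    hd.isFrechetProcess hα fun t => memLPlus_indicator hα (hfm t) measurableSet_discPart, ?_, ?_,
    hminc.hasStandardizedSupport hα, hmind.hasStandardizedSupport hα, hminc, hmind⟩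
  -- The sup-measure `M₀` that represents `X` need not be `M`; the two processes of extremal
  -- integrals share the exponent of `f`, hence the law.
  · obtain ⟨-, Ω₀, _, P₀, _, M₀, hM₀, hX₀⟩ := hf.spectral
    have h := (hM.hasExponent hα hfm).congr (fun t => (hc.measurable t).sup (hd.measurable t))
      (contComponent_sup_discComponent_ae_eq hα hM hfm)
    exact IdentDistrib.trans hX₀ ((hM₀.hasExponent hα hfm).eqInDist h)
  · intro J K g hg
    obtain ⟨hJ, hK, hcont, hdisc⟩ := hf.unique hα hg (hf.spectral.exponent_eq hα hg.spectral)
    refine ⟨hJ, hK, fun Ω₂ _ P₂ _ M₂ hM₂ => ⟨?_, ?_⟩⟩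
    · refine hc.eqInDist ?_
      rw [hcont]
      exact hasExponent_contComponent hα hM₂ hg.spectral.1
    · refine hd.eqInDist ?_
      rw [hdisc]
      exact hasExponent_discComponent hα hM₂ hg.spectral.1
  · refine hM.indepFun_extremalIntegral hα
      (fun t => memLPlus_indicator hα (hfm t) measurableSet_contPart)
      (fun t => memLPlus_indicator hα (hfm t) measurableSet_discPart) fun t u x => ?_
    by_cases hx : x ∈ contPart I N
    · right
      rw [← compl_contPart]
      exact indicator_of_notMem (notMem_compl_iff.2 hx) _
    · left
      exact indicator_of_notMem hx _
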